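/- Let $\Sigma\subset\mathbb R^2$ be a domain and let $f\colon\Sigma\to\mathbb R^3$ be a front with Gauss map $\nu\colon\Sigma\to S^2$; that is, $f$ and $\nu$ are $C^\infty$, $\langle df_q(X),\nu(q)\rangle=0$ for all $q\in\Sigma$ and $X\in\mathbb R^2$, and $(f,\nu)\colon\Sigma\to\mathbb R^3\times S^2$ is an immersion. Write $S(f)=\{q\in\Sigma : \operatorname{rank} df_q<2\}$ and $S(\nu)=\{q\in\Sigma:\operatorname{rank} d\nu_q<2\}$. Let $p\in S(f)$ be a cuspidal edge of $f$, i.e. the germ of $f$ at $p$ is $\mathcal A$-equivalent (up to $C^\infty$ local diffeomorphisms of source and target) to $(u,v)\mapsto(u,v^2,v^3)$ at the origin. Suppose that the Gaussian curvature $K$ of $f$ is non-zero and bounded near $p$, i.e. there are a neighbourhood $U$ of $p$ and a constant $C$ with $K(q)\ne0$ and $|K(q)|\le C$ for all $q\in U\setminus S(f)$. Let $(u,v)$ be any adapted coordinate system centered at $p$: positively oriented local coordinates with $p=(0,0)$, in whose domain $S(f)$ is the $u$-axis $\{v=0\}$ and $f_v=0$ along it. (Such coordinates exist at every cuspidal edge.)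 With $\lambda=\det(f_u,f_v,\nu)$, the singular curvature and the cuspidal torsion at $p$ are the values at the origin of $$\kappa_s=\operatorname{sgn}(\lambda_v)\frac{\det(f_u,f_{uu},\nu)}{|f_u|^3},\qquad \kappa_t=\frac{\det(f_u,f_{vv},f_{uvv})}{|f_u\times f_{vv}|^2}-\frac{\langle f_u,f_{vv}\rangle\det(f_u,f_{vv},f_{uu})}{|f_u|^2|f_u\times f_{vv}|^2}.$$ Call $p$ a non-degenerate singular point of $\nu$ if $p\in S(\nu)$ and $d\kappa_p\neq0$, where $\kappa$ is the bounded principal curvature of $f$ near $p$, i.e. the $C^\infty$ function on a neighbourhood of $p$ which at each regular point of $f$ there equals one of the principal curvatures $H\pm\sqrt{H^2-K}$ ($H$ being the mean curvature). The map $\nu$ has a fold at $p$ if its germ at $p$ is $\mathcal A$-equivalent to $(u,v)\mapsto(u,v^2)$ at the origin. Then $p$ is a non-degenerate singular point of $\nu$ other than a fold if and only if $\kappa_t(p)=0$ and $\kappa_s(p)\neq0$. -/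

import Mathlib

open Set Filter Topology Manifold
open scoped ContDiff

-- Euclidean spaces carry their standard charted space structure.
attribute [instance 2000] chartedSpaceSelf

noncomputable section

namespace GaussMapCusp

/-- The source plane; only its smooth structure and its orientation matter. -/
abbrev Plane : Type := ℝ × ℝ

/-- Euclidean 3-space. -/
abbrev E3 : Type := EuclideanSpace ℝ (Fin 3)

/-- The unit sphere of Euclidean 3-space, with Mathlib's smooth structure. -/
abbrev S2 : Type := Metric.sphere (0 : E3) 1

/-! ### Linear algebra in 3-space and partial derivatives -/

/-- The determinant `det(a, b, c)` of three vectors. -/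
def det3 (a b c : E3) : ℝ := Matrix.det (Matrix.of ![a.ofLp, b.ofLp, c.ofLp])

/-- The vector product `a × b`. -/
def cross (a b : E3) : E3 := WithLp.toLp 2 (crossProduct a.ofLp b.ofLp)

/-- The partial derivative with respect to the first coordinate `u`. -/
def du {F : Type*} [NormedAddCommGroup F] [NormedSpace ℝ F] (g : Plane → F) (q : Plane) : F :=
  fderiv ℝ g q (1, 0)

/-- The partial derivative with respect to the second coordinate `v`. -/
def dv {F : Type*} [NormedAddCommGroup F] [NormedSpace ℝ F] (g : Plane → F) (q : Plane) : F :=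
  fderiv ℝ g q (0, 1)

/-! ### Fronts, singular points, map germs -/

/-- The Gauss map regarded as a map into 3-space. -/
def ambient (ν : Plane → S2) : Plane → E3 := fun q => (ν q : E3)

/-- `f : D → ℝ³` is a front with Gauss map `ν : D → S²`. -/
structure IsFront (D : Set Plane) (f : Plane → E3) (ν : Plane → S2) : Prop where
  smooth : ContDiffOn ℝ ∞ f D
  smooth_gauss : ContMDiffOn 𝓘(ℝ, Plane) (𝓡 2) ∞ ν D
  orthogonal : ∀ q ∈ D, ∀ X : Plane, inner ℝ (fderiv ℝ f q X) (ν q : E3) = 0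
  immersion : ∀ q ∈ D, Function.Injective (fderiv ℝ (fun q' => (f q', ambient ν q')) q)

/-- The singular set `S(g) = {q ∈ D | rank dg_q < 2}`. -/
def singularSet (D : Set Plane) (g : Plane → E3) : Set Plane :=
  {q ∈ D | Module.finrank ℝ (LinearMap.range (fderiv ℝ g q).toLinearMap) < 2}

/-- The germ of `f : M → N` at `p` is `𝒜`-equivalent to the germ at the origin of the map
`g : E → F` with `g 0 = 0`: there are local diffeomorphisms `φ` at `p` with `φ p = 0` and `Φ` at
`f p` such that `Φ ∘ f = g ∘ φ` near `p` (hence `Φ (f p) = 0`). -/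
def AEquivAt {E F E₁ F₁ H₁ H₂ M N : Type*}
    [NormedAddCommGroup E] [NormedSpace ℝ E] [NormedAddCommGroup F] [NormedSpace ℝ F]
    [NormedAddCommGroup E₁] [NormedSpace ℝ E₁] [NormedAddCommGroup F₁] [NormedSpace ℝ F₁]
    [TopologicalSpace H₁] [TopologicalSpace H₂]
    [TopologicalSpace M] [ChartedSpace H₁ M] [TopologicalSpace N] [ChartedSpace H₂ N]
    (I : ModelWithCorners ℝ E₁ H₁) (J : ModelWithCorners ℝ F₁ H₂)
    (f : M → N) (p : M) (g : E → F) : Prop :=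
  ∃ (φ : PartialDiffeomorph I 𝓘(ℝ, E) M E ∞) (Φ : PartialDiffeomorph J 𝓘(ℝ, F) N F ∞),
    p ∈ φ.source ∧ φ p = 0 ∧ f p ∈ Φ.source ∧ ∀ᶠ q in 𝓝 p, Φ (f q) = g (φ q)

/-- `p` is a cuspidal edge of `f : D → ℝ³`: a singular point at which `f` is `𝒜`-equivalent to
`(u, v) ↦ (u, v², v³)`. -/
def IsCuspidalEdge (D : Set Plane) (f : Plane → E3) (p : Plane) : Prop :=
  p ∈ singularSet D f ∧
    AEquivAt 𝓘(ℝ, Plane) 𝓘(ℝ, E3) f p (fun q : Plane => (!₂[q.1, q.2 ^ 2, q.2 ^ 3] : E3))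

/-- `ν : D → S²` has a fold at `p`: it is `𝒜`-equivalent to `(u, v) ↦ (u, v²)`. -/
def IsFold (ν : Plane → S2) (p : Plane) : Prop :=
  AEquivAt 𝓘(ℝ, Plane) (𝓡 2) ν p (fun q : Plane => ((q.1, q.2 ^ 2) : ℝ × ℝ))

/-! ### Curvatures at regular points

Here `f` is the surface and `n` its unit normal as a map into 3-space. The values are meaningful
at regular points of `f`, and are used only there. -/

def formE (f : Plane → E3) (q : Plane) : ℝ := inner ℝ (du f q) (du f q)
def formF (f : Plane → E3) (q : Plane) : ℝ := inner ℝ (du f q) (dv f q)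
def formG (f : Plane → E3) (q : Plane) : ℝ := inner ℝ (dv f q) (dv f q)
def formL (f n : Plane → E3) (q : Plane) : ℝ := -inner ℝ (du f q) (du n q)
def formM (f n : Plane → E3) (q : Plane) : ℝ := -inner ℝ (dv f q) (du n q)
def formN (f n : Plane → E3) (q : Plane) : ℝ := -inner ℝ (dv f q) (dv n q)

/-- The Gaussian curvature `K`. -/
def gaussCurv (f n : Plane → E3) (q : Plane) : ℝ :=
  (formL f n q * formN f n q - formM f n q ^ 2) / (formE f q * formG f q - formF f q ^ 2)

/-- The mean curvature `H`. -/
def meanCurv (f n : Plane → E3) (q : Plane) : ℝ :=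
  (formE f q * formN f n q - 2 * formF f q * formM f n q + formG f q * formL f n q) /
    (2 * (formE f q * formG f q - formF f q ^ 2))

/-- The principal curvature `κ₁ = H + √(H² - K)`. -/
def kappa1 (f n : Plane → E3) (q : Plane) : ℝ :=
  meanCurv f n q + √(meanCurv f n q ^ 2 - gaussCurv f n q)

/-- The principal curvature `κ₂ = H - √(H² - K)`. -/
def kappa2 (f n : Plane → E3) (q : Plane) : ℝ :=
  meanCurv f n q - √(meanCurv f n q ^ 2 - gaussCurv f n q)

/-- `κ` is a `C^∞` function on the neighbourhood `V` of `p` which extends a principal curvature of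
the front across its singular set. The mean curvature changes sign across the singular curve of a
cuspidal edge, so which of `κ₁`, `κ₂` is the bounded one may depend on the side. -/
structure IsBoundedPrincipalCurv (D : Set Plane) (f : Plane → E3) (ν : Plane → S2) (p : Plane)
    (V : Set Plane) (κ : Plane → ℝ) : Prop where
  isOpen : IsOpen V
  mem : p ∈ V
  subset : V ⊆ D
  smooth : ContDiffOn ℝ ∞ κ V
  principal : ∀ q ∈ V \ singularSet D f,
    κ q = kappa1 f (ambient ν) q ∨ κ q = kappa2 f (ambient ν) q

/-- `p` is a non-degenerate singular point of the Gauss map `ν` of the front `f`: it is a singular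
point of `ν` and the bounded principal curvature `κ` has `(∂κ/∂u, ∂κ/∂v) ≠ (0, 0)` at `p`. -/
def IsNondegenerateSingularPoint (D : Set Plane) (f : Plane → E3) (ν : Plane → S2)
    (p : Plane) : Prop :=
  p ∈ singularSet D (ambient ν) ∧
    ∃ (V : Set Plane) (κ : Plane → ℝ), IsBoundedPrincipalCurv D f ν p V κ ∧
      (du κ p, dv κ p) ≠ (0, 0)

/-- The Gaussian curvature is non-zero and bounded near `p` (at the regular points of `f`). -/
def GaussCurvNonzeroBoundedNear (D : Set Plane) (f : Plane → E3) (ν : Plane → S2)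
    (p : Plane) : Prop :=
  ∃ C : ℝ, ∀ᶠ q in 𝓝 p, q ∉ singularSet D f →
    gaussCurv f (ambient ν) q ≠ 0 ∧ |gaussCurv f (ambient ν) q| ≤ C

/-! ### Adapted coordinates and the invariants of a cuspidal edge -/

/-- A local coordinate system `x = (u, v)` of `D`, with domain `x.source`, is adapted and centered
at `p`: it is positively oriented, the singular points of `f` in its domain are exactly those on the
`u`-axis, and `∂/∂v` is a null vector along the `u`-axis. -/
structure IsAdapted (D : Set Plane) (f : Plane → E3) (p : Plane)
    (x : PartialDiffeomorph 𝓘(ℝ, Plane) 𝓘(ℝ, Plane) Plane Plane ∞) : Prop where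
  subset : x.source ⊆ D
  mem : p ∈ x.source
  centered : x p = 0
  oriented : ∀ q ∈ x.source, 0 < (fderiv ℝ x q).det
  singular_iff : ∀ q ∈ x.source, q ∈ singularSet D f ↔ (x q).2 = 0
  null : ∀ u : ℝ, (u, (0 : ℝ)) ∈ x.target → dv (f ∘ x.symm) (u, 0) = 0

/-- The signed area density function `λ = det(f_u, f_v, ν)`. -/
def areaDensity (f n : Plane → E3) (q : Plane) : ℝ := det3 (du f q) (dv f q) (n q)

/-- The singular curvature `κ_s = sgn(λ_v) det(f_u, f_uu, ν) / |f_u|³`, for `f` and its unit normal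
`n` written in adapted coordinates. -/
def singularCurv (f n : Plane → E3) (q : Plane) : ℝ :=
  Real.sign (dv (areaDensity f n) q) * (det3 (du f q) (du (du f) q) (n q) / ‖du f q‖ ^ 3)

/-- The cuspidal torsion
`κ_t = det(f_u, f_vv, f_uvv) / |f_u × f_vv|²
  - ⟨f_u, f_vv⟩ det(f_u, f_vv, f_uu) / (|f_u|² |f_u × f_vv|²)`,
for `f` written in adapted coordinates. -/
def cuspidalTorsion (f : Plane → E3) (q : Plane) : ℝ :=
  det3 (du f q) (dv (dv f) q) (dv (dv (du f)) q) / ‖cross (du f q) (dv (dv f) q)‖ ^ 2 -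
    inner ℝ (du f q) (dv (dv f) q) * det3 (du f q) (dv (dv f) q) (du (du f) q) /
      (‖du f q‖ ^ 2 * ‖cross (du f q) (dv (dv f) q)‖ ^ 2)


/-! ### Adapted coordinates exist at every cuspidal edge -/

/-- The map `(u, v) ↦ (u, v², s v³)`, for a sign `s`. -/
def edgeModel (s : ℝ) (q : Plane) : E3 := !₂[q.1, q.2 ^ 2, s * q.2 ^ 3]

theorem hasFDerivAt_edgeModel (s : ℝ) (q : Plane) :
    ∃ L : Plane →L[ℝ] E3, HasFDerivAt (edgeModel s) L q ∧
      ∀ w : Plane, L w = !₂[w.1, 2 * q.2 * w.2, 3 * s * q.2 ^ 2 * w.2] := by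
  have h1 : HasFDerivAt (fun q : Plane => q.1) (ContinuousLinearMap.fst ℝ ℝ ℝ) q := hasFDerivAt_fst
  have h2 : HasFDerivAt (fun q : Plane => q.2) (ContinuousLinearMap.snd ℝ ℝ ℝ) q := hasFDerivAt_snd
  have h3 := h2.pow 2
  have h4 := (h2.pow 3).const_mul s
  let L : Plane →L[ℝ] (Fin 3 → ℝ) := ContinuousLinearMap.pi ![ContinuousLinearMap.fst ℝ ℝ ℝ,
    (2 * q.2) • ContinuousLinearMap.snd ℝ ℝ ℝ, (3 * s * q.2 ^ 2) • ContinuousLinearMap.snd ℝ ℝ ℝ]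
  refine ⟨(PiLp.continuousLinearEquiv 2 ℝ (fun _ : Fin 3 => ℝ)).symm.toContinuousLinearMap ∘L L,
    ?_, ?_⟩
  · have : HasFDerivAt (fun q : Plane => (![q.1, q.2 ^ 2, s * q.2 ^ 3] : Fin 3 → ℝ)) L q := by
      rw [hasFDerivAt_pi']
      intro i
      fin_cases i
      · exact h1
      · refine h3.congr_fderiv ?_
        ext <;> simp [L]
      · refine h4.congr_fderiv ?_
        ext <;> simp [L]
        ring
    exact ((PiLp.continuousLinearEquiv 2 ℝ
      (fun _ : Fin 3 => ℝ)).symm.toContinuousLinearMap.hasFDerivAt).comp q this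
  · intro w
    ext i
    fin_cases i <;> simp [L]

theorem finrank_range_lt_two_iff (L : Plane →L[ℝ] E3) :
    Module.finrank ℝ (LinearMap.range L.toLinearMap) < 2 ↔ ¬ Function.Injective L := by
  have h := L.toLinearMap.finrank_range_add_finrank_ker
  have h2 : Module.finrank ℝ Plane = 2 := by simp [Plane]
  rw [h2] at h
  constructor
  · intro hlt hinj
    have : LinearMap.ker L.toLinearMap = ⊥ := LinearMap.ker_eq_bot.2 hinj
    rw [this, finrank_bot] at h
    omega
  · intro hn
    by_contra hge
    have h0 : Module.finrank ℝ (LinearMap.ker L.toLinearMap) = 0 := by omega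
    exact hn (LinearMap.ker_eq_bot.1 (Submodule.finrank_eq_zero.1 h0))

theorem partialDiffeo_deriv {E F : Type*} [NormedAddCommGroup E] [NormedSpace ℝ E]
    [NormedAddCommGroup F] [NormedSpace ℝ F]
    (φ : PartialDiffeomorph 𝓘(ℝ, E) 𝓘(ℝ, F) E F ∞) {q : E} (hq : q ∈ φ.source) :
    ∃ (A : E →L[ℝ] F) (B : F →L[ℝ] E), HasFDerivAt φ A q ∧ HasFDerivAt φ.symm B (φ q) ∧
      B ∘L A = ContinuousLinearMap.id ℝ E ∧ A ∘L B = ContinuousLinearMap.id ℝ F := by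
  have h1 : DifferentiableAt ℝ φ q :=
    (φ.contMDiffOn_toFun.contDiffOn.contDiffAt (φ.open_source.mem_nhds hq)).differentiableAt
      (by simp)
  have hq' : φ q ∈ φ.target := φ.map_source hq
  have h2 : DifferentiableAt ℝ φ.symm (φ q) :=
    (φ.contMDiffOn_invFun.contDiffOn.contDiffAt (φ.open_target.mem_nhds hq')).differentiableAt
      (by simp)
  have e : φ.symm (φ q) = q := φ.left_inv hq
  refine ⟨_, _, h1.hasFDerivAt, h2.hasFDerivAt, ?_, ?_⟩
  · refine HasFDerivAt.unique (h2.hasFDerivAt.comp q h1.hasFDerivAt) ?_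
    refine (hasFDerivAt_id q).congr_of_eventuallyEq ?_
    filter_upwards [φ.open_source.mem_nhds hq] with y hy
    exact φ.left_inv hy
  · have h1' : HasFDerivAt φ (fderiv ℝ φ q) (φ.symm (φ q)) := by rw [e]; exact h1.hasFDerivAt
    refine HasFDerivAt.unique (h1'.comp (φ q) h2.hasFDerivAt) ?_
    refine (hasFDerivAt_id (φ q)).congr_of_eventuallyEq ?_
    filter_upwards [φ.open_target.mem_nhds hq'] with y hy
    exact φ.right_inv hy

/-- The restriction of a local diffeomorphism to a smaller open set. -/
def restrOpen (φ : PartialDiffeomorph 𝓘(ℝ, Plane) 𝓘(ℝ, Plane) Plane Plane ∞) (W : Set Plane)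
    (hW : IsOpen W) : PartialDiffeomorph 𝓘(ℝ, Plane) 𝓘(ℝ, Plane) Plane Plane ∞ where
  toPartialEquiv := φ.toPartialEquiv.restr W
  open_source := φ.open_source.inter hW
  open_target := (φ.toOpenPartialHomeomorph.restrOpen W hW).open_target
  contMDiffOn_toFun := φ.contMDiffOn_toFun.mono inter_subset_left
  contMDiffOn_invFun := φ.contMDiffOn_invFun.mono inter_subset_left

theorem exists_isAdapted_aux {D : Set Plane} (hD : IsOpen D) {f : Plane → E3} {p : Plane}
    (hp : p ∈ D) (hf : ContinuousAt f p) (s : ℝ)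
    (φ : PartialDiffeomorph 𝓘(ℝ, Plane) 𝓘(ℝ, Plane) Plane Plane ∞)
    (Φ : PartialDiffeomorph 𝓘(ℝ, E3) 𝓘(ℝ, E3) E3 E3 ∞)
    (hpφ : p ∈ φ.source) (h0 : φ p = 0) (hpΦ : f p ∈ Φ.source)
    (h : ∀ᶠ q in 𝓝 p, Φ (f q) = edgeModel s (φ q))
    (hdet : 0 < (fderiv ℝ φ p).det) : ∃ x, IsAdapted D f p x := by
  have hcd : ContinuousAt (fun q => (fderiv ℝ φ q).det) p := by
    have h1 : ContDiffAt ℝ ∞ φ p :=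
      φ.contMDiffOn_toFun.contDiffOn.contDiffAt (φ.open_source.mem_nhds hpφ)
    exact ContinuousLinearMap.continuous_det.continuousAt.comp
      (h1.continuousAt_fderiv (by simp))
  have hev : ∀ᶠ q in 𝓝 p, q ∈ D ∧ f q ∈ Φ.source ∧ Φ (f q) = edgeModel s (φ q) ∧
      0 < (fderiv ℝ φ q).det := by
    filter_upwards [hD.mem_nhds hp, hf.preimage_mem_nhds (Φ.open_source.mem_nhds hpΦ), h,
      hcd.eventually (lt_mem_nhds hdet)] with q a b c d using ⟨a, b, c, d⟩
  obtain ⟨W, hW, hWo, hpW⟩ := eventually_nhds_iff.1 hev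
  -- on `W ∩ φ.source` the map `f` is `Φ⁻¹ ∘ model ∘ φ`
  have key : ∀ q ∈ W ∩ φ.source, ∃ (G : Plane →L[ℝ] E3) (A B : Plane →L[ℝ] Plane)
      (C : E3 →L[ℝ] E3), HasFDerivAt f (C ∘L G ∘L A) q ∧ HasFDerivAt φ.symm B (φ q) ∧
      B ∘L A = ContinuousLinearMap.id ℝ Plane ∧ A ∘L B = ContinuousLinearMap.id ℝ Plane ∧
      Function.Injective C ∧
      ∀ w : Plane, G w = !₂[w.1, 2 * (φ q).2 * w.2, 3 * s * (φ q).2 ^ 2 * w.2] := by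
    intro q hq
    obtain ⟨A, B, hA, hB, hBA, hAB⟩ := partialDiffeo_deriv φ hq.2
    obtain ⟨_, hs, he, _⟩ := hW q hq.1
    obtain ⟨A', C, _, hC, _, hAC⟩ := partialDiffeo_deriv Φ hs
    obtain ⟨G, hG, hG'⟩ := hasFDerivAt_edgeModel s (φ q)
    refine ⟨G, A, B, C, ?_, hB, hBA, hAB, ?_, hG'⟩
    · rw [he] at hC
      refine (hC.comp q (hG.comp q hA)).congr_of_eventuallyEq ?_
      filter_upwards [hWo.mem_nhds hq.1] with y hy
      obtain ⟨_, hs', he', _⟩ := hW y hy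
      have := Φ.left_inv hs'
      simp only [Function.comp]
      rw [← he']
      exact this.symm
    · intro a b hab
      have ha := congrArg (fun T : E3 →L[ℝ] E3 => T a) hAC
      have hb := congrArg (fun T : E3 →L[ℝ] E3 => T b) hAC
      simp only [ContinuousLinearMap.comp_apply, ContinuousLinearMap.id_apply] at ha hb
      rw [← ha, ← hb, hab]
  refine ⟨restrOpen φ W hWo, ?_, ?_, ?_, ?_, ?_, ?_⟩
  · rintro q ⟨_, hq⟩
    exact (hW q hq).1
  · exact ⟨hpφ, hpW⟩
  · exact h0
  · rintro q ⟨_, hq⟩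
    exact (hW q hq).2.2.2
  · rintro q ⟨hqs, hq⟩
    obtain ⟨G, A, B, C, hfd, -, hBA, hAB, hC, hG⟩ := key q ⟨hq, hqs⟩
    have hqD := (hW q hq).1
    have hAB' : ∀ w, A (B w) = w := fun w => congrArg (fun T : Plane →L[ℝ] Plane => T w) hAB
    have hBA' : ∀ w, B (A w) = w := fun w => congrArg (fun T : Plane →L[ℝ] Plane => T w) hBA
    have e : (q ∈ singularSet D f) ↔ ¬ Function.Injective (C ∘L G ∘L A) := by
      rw [← finrank_range_lt_two_iff, ← hfd.fderiv]
      exact ⟨fun h => h.2, fun h => ⟨hqD, h⟩⟩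
    rw [e]
    change _ ↔ (φ q).2 = 0
    constructor
    · intro hn
      by_contra hv
      apply hn
      have hGi : Function.Injective G := by
        intro a b hab
        rw [hG, hG] at hab
        have h1 := congrArg (fun z : E3 => z 0) hab
        have h2 := congrArg (fun z : E3 => z 1) hab
        simp at h1 h2
        rcases h2 with h2 | h2
        · exact Prod.ext h1 h2
        · exact absurd h2 hv
      exact hC.comp (hGi.comp (Function.LeftInverse.injective hBA'))
    · intro hv hinj
      have : B (0, 1) = 0 := by
        apply hinj
        simp only [ContinuousLinearMap.comp_apply, hAB', map_zero]
        rw [hG, hv]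
        have : (!₂[(0 : ℝ), 2 * 0 * 1, 3 * s * 0 ^ 2 * 1] : E3) = 0 := by
          ext i
          fin_cases i <;> simp
        rw [this, map_zero]
      have h2 := hAB' (0, 1)
      rw [this, map_zero] at h2
      simpa using congrArg Prod.snd h2
  · intro u hu
    have hu' : ((u, (0 : ℝ)) : Plane) ∈ φ.target := hu.1
    have huW : φ.symm (u, 0) ∈ W := hu.2
    have hus : φ.symm (u, 0) ∈ φ.source := φ.map_target hu'
    have er : φ (φ.symm (u, 0)) = (u, 0) := φ.right_inv hu'
    obtain ⟨G, A, B, C, hfd, hB, -, hAB, -, hG⟩ := key _ ⟨huW, hus⟩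
    rw [er] at hB hG
    have hd : HasFDerivAt (f ∘ φ.symm) ((C ∘L G ∘L A) ∘L B) (u, 0) := hfd.comp (u, (0 : ℝ)) hB
    have hAB' : ∀ w, A (B w) = w := fun w => congrArg (fun T : Plane →L[ℝ] Plane => T w) hAB
    change fderiv ℝ (f ∘ φ.symm) (u, 0) (0, 1) = 0
    rw [hd.fderiv]
    simp only [ContinuousLinearMap.comp_apply, hAB']
    rw [hG]
    have : (!₂[(0 : ℝ), 2 * 0 * 1, 3 * s * 0 ^ 2 * 1] : E3) = 0 := by
      ext i
      fin_cases i <;> simp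
    rw [this, map_zero]

/-- The reflection `(u, v) ↦ (u, -v)`. -/
def reflectV : Plane ≃L[ℝ] Plane :=
  (ContinuousLinearEquiv.refl ℝ ℝ).prodCongr (ContinuousLinearEquiv.neg ℝ)

theorem det_reflectV : (reflectV : Plane →L[ℝ] Plane).det = -1 := by
  have : ((reflectV : Plane →L[ℝ] Plane) : Plane →ₗ[ℝ] Plane) =
      LinearMap.prodMap (LinearMap.id) (-LinearMap.id) := by
    ext <;> simp [reflectV]
  rw [ContinuousLinearMap.det, this, LinearMap.det_prodMap]
  simp

/-- Every cuspidal edge has an adapted coordinate system, so that its invariants are defined. -/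
theorem exists_isAdapted {D : Set Plane} (hD : IsOpen D) {f : Plane → E3}
    (hf : ContDiffOn ℝ ∞ f D) {p : Plane} (hp : IsCuspidalEdge D f p) :
    ∃ x, IsAdapted D f p x := by
  obtain ⟨⟨hpD, -⟩, φ, Φ, hpφ, h0, hpΦ, h⟩ := hp
  have hfc : ContinuousAt f p := hf.continuousOn.continuousAt (hD.mem_nhds hpD)
  have hne : (fderiv ℝ φ p).det ≠ 0 := by
    obtain ⟨A, B, hA, -, -, hAB⟩ := partialDiffeo_deriv φ hpφ
    rw [hA.fderiv]
    intro hz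
    have := congrArg (fun T : Plane →L[ℝ] Plane => LinearMap.det (T : Plane →ₗ[ℝ] Plane)) hAB
    simp only [ContinuousLinearMap.toLinearMap_comp, LinearMap.det_comp] at this
    rw [ContinuousLinearMap.det] at hz
    rw [hz] at this
    simp at this
  rcases lt_or_gt_of_ne hne with hneg | hpos
  · let ρ : PartialDiffeomorph 𝓘(ℝ, Plane) 𝓘(ℝ, Plane) Plane Plane ∞ :=
      reflectV.toDiffeomorph.toPartialDiffeomorph
    have hρ : ∀ q : Plane, ρ q = (q.1, -q.2) := fun q => rfl
    have hφρ : ∀ q, (φ.trans ρ) q = reflectV (φ q) := fun q => rfl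
    refine exists_isAdapted_aux hD hpD hfc (-1) (φ.trans ρ) Φ ⟨hpφ, trivial⟩ ?_ hpΦ ?_ ?_
    · rw [hφρ, h0, map_zero]
    · filter_upwards [h] with q hq
      rw [hq, hφρ]
      simp only [edgeModel, reflectV]
      ext i
      fin_cases i <;> simp
      ring
    · have hd : HasFDerivAt φ (fderiv ℝ φ p) p := by
        obtain ⟨A, B, hA, -, -, hAB⟩ := partialDiffeo_deriv φ hpφ
        exact hA.differentiableAt.hasFDerivAt
      have hd2 : HasFDerivAt (φ.trans ρ) ((reflectV : Plane →L[ℝ] Plane) ∘L fderiv ℝ φ p) p :=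
        (reflectV : Plane →L[ℝ] Plane).hasFDerivAt.comp p hd
      rw [hd2.fderiv]
      have : ((reflectV : Plane →L[ℝ] Plane) ∘L fderiv ℝ φ p).det =
          (reflectV : Plane →L[ℝ] Plane).det * (fderiv ℝ φ p).det := by
        simp [ContinuousLinearMap.det, LinearMap.det_comp]
      rw [this, det_reflectV]
      linarith
  · refine exists_isAdapted_aux hD hpD hfc 1 φ Φ hpφ h0 hpΦ ?_ hpos
    filter_upwards [h] with q hq
    rw [hq]
    simp [edgeModel]

end GaussMapCusp

end

/-!
In adapted coordinates centered at `p` write `f_v = v h` (Hadamard's lemma). At a cuspidal edge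
`f_u` and `h` are linearly independent, so `f_u, h, ν` is a frame along the singular curve `v = 0`.
With respect to it the first fundamental form has determinant `v² D̂` with `D̂ > 0`, and the second
one has the coefficients `M = v M̂`, `N = v N̂` with `M̂ = -⟨h, ν_u⟩`, `N̂ = -⟨h, ν_v⟩`. The
immersion condition for `(f, ν)` says that `N̂(p) ≠ 0` (`IsEdgeGerm.hatN_ne_zero`), and boundedness of
`K = (L N̂ / v - M̂²) / D̂` then forces `L = v L̂` (`IsEdgeGerm.formL_eq_zero`). Put
`Ĉ = L̂ N̂ - M̂²`, so that `K = Ĉ / D̂`. In the declarations below `L̂` is the function `l`. The theorem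
follows from four equivalences at `p`.

* `p` is a non-degenerate singular point of `ν` if and only if `Ĉ ≠ 0`
  (`IsEdgeData.isNondegenerate_iff`). A principal curvature `κ` solves
  `v D̂ κ² - B̂ κ + v Ĉ = 0`, where `B̂(p) ≠ 0`; so the smooth one vanishes on the axis and has the
  differential `(0, Ĉ / B̂)` at `p`. It is given explicitly by the quadratic formula.
* `κ_t = 0` if and only if `M̂ = 0` (`IsEdgeGerm.cuspidalTorsion_eq_zero_iff`).
* `κ_s ≠ 0` if and only if `L̂ ≠ 0` (`IsEdgeGerm.singularCurv_ne_zero_iff`), since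
  `L̂ = ⟨f_uu, ν_v⟩` at `p`.
* If `Ĉ ≠ 0`, then `ν` has a fold if and only if `M̂ ≠ 0`. The kernel of `dν` along the axis is spanned
  by `N̂ ∂_u - M̂ ∂_v`, which is tangent to the axis at `p` exactly if `M̂ = 0`. For a fold this kernel
  is transverse to the singular curve (`IsEdgeData.not_isFold`). Conversely, in coordinates of the
  sphere the Jacobian determinant of `ν` is `v Ĉ` up to a non-vanishing factor, and a map of the
  plane with a transverse kernel whose Jacobian determinant vanishes to first order along the axis
  has the normal form `(u, v²)` (`exists_fold_normal_form`, `IsEdgeData.isFold`).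

Hence `p` is non-degenerate and not a fold exactly if `M̂ = 0` and `L̂ N̂ ≠ 0`, that is, if `κ_t = 0` and
`κ_s ≠ 0`.
-/

noncomputable section

namespace GaussMapCusp

/-! ### Smooth functions near a point of the plane -/

/-- An identity between continuous functions valid off the axis `v = 0` also holds on it. -/
theorem eventually_eq_of_off_axis {X : Type*} [TopologicalSpace X] [T2Space X] {g k : Plane → X}
    (hg : Continuous g) (hk : Continuous k)
    (h : ∀ᶠ q in 𝓝 (0 : Plane), q.2 ≠ 0 → g q = k q) : ∀ᶠ q in 𝓝 (0 : Plane), g q = k q := by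
  filter_upwards [h.eventually_nhds] with q hq
  by_cases h0 : q.2 = 0
  · have hc : ContinuousAt (fun t : ℝ => ((q.1, t) : Plane)) 0 := by fun_prop
    have e0 : ((q.1, (0 : ℝ)) : Plane) = q := Prod.ext rfl h0.symm
    have hm : ∀ᶠ t in 𝓝[≠] (0 : ℝ), g (q.1, t) = k (q.1, t) := by
      have h1 : ∀ᶠ t in 𝓝 (0 : ℝ), t ≠ 0 → g (q.1, t) = k (q.1, t) := by
        rw [← e0] at hq
        exact hc.tendsto.eventually hq
      filter_upwards [h1.filter_mono nhdsWithin_le_nhds, self_mem_nhdsWithin] with t ht ht0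
      exact ht ht0
    have h1 : Tendsto (fun t : ℝ => g (q.1, t)) (𝓝[≠] 0) (𝓝 (g (q.1, 0))) :=
      (Continuous.tendsto (by fun_prop : Continuous fun t : ℝ => g (q.1, t)) 0).mono_left
        nhdsWithin_le_nhds
    have h2 : Tendsto (fun t : ℝ => k (q.1, t)) (𝓝[≠] 0) (𝓝 (k (q.1, 0))) :=
      (Continuous.tendsto (by fun_prop : Continuous fun t : ℝ => k (q.1, t)) 0).mono_left
        nhdsWithin_le_nhds
    rw [← e0]
    exact tendsto_nhds_unique (h1.congr' hm) h2
  · exact hq.self_of_nhds h0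

section Calculus

variable {F : Type} [NormedAddCommGroup F] [NormedSpace ℝ F]

theorem contDiffAt_du {g : Plane → F} {q : Plane} (hg : ContDiffAt ℝ ∞ g q) :
    ContDiffAt ℝ ∞ (du g) q :=
  (hg.fderiv_right (m := ∞) (by simp)).clm_apply contDiffAt_const

theorem contDiffAt_dv {g : Plane → F} {q : Plane} (hg : ContDiffAt ℝ ∞ g q) :
    ContDiffAt ℝ ∞ (dv g) q :=
  (hg.fderiv_right (m := ∞) (by simp)).clm_apply contDiffAt_const

theorem contDiff_du {g : Plane → F} (hg : ContDiff ℝ ∞ g) : ContDiff ℝ ∞ (du g) :=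
  contDiff_iff_contDiffAt.2 fun q => contDiffAt_du (contDiff_iff_contDiffAt.1 hg q)

theorem contDiff_dv {g : Plane → F} (hg : ContDiff ℝ ∞ g) : ContDiff ℝ ∞ (dv g) :=
  contDiff_iff_contDiffAt.2 fun q => contDiffAt_dv (contDiff_iff_contDiffAt.1 hg q)

theorem fderiv_apply_eq_du_dv (g : Plane → F) (q w : Plane) :
    fderiv ℝ g q w = w.1 • du g q + w.2 • dv g q := by
  have : w = w.1 • ((1, 0) : Plane) + w.2 • ((0, 1) : Plane) := by ext <;> simp
  conv_lhs => rw [this]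
  rw [map_add, map_smul, map_smul]
  rfl

theorem du_congr {g k : Plane → F} {q : Plane} (h : g =ᶠ[𝓝 q] k) : du g =ᶠ[𝓝 q] du k := by
  filter_upwards [h.fderiv (𝕜 := ℝ)] with y hy
  simp only [du, hy]

theorem dv_congr {g k : Plane → F} {q : Plane} (h : g =ᶠ[𝓝 q] k) : dv g =ᶠ[𝓝 q] dv k := by
  filter_upwards [h.fderiv (𝕜 := ℝ)] with y hy
  simp only [dv, hy]

theorem dv_du_comm {g : Plane → F} {q : Plane} (hg : ContDiffAt ℝ ∞ g q) :
    dv (du g) q = du (dv g) q := by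
  have hs : IsSymmSndFDerivAt ℝ g q :=
    hg.isSymmSndFDerivAt (by
      rw [minSmoothness_of_isRCLikeNormedField]
      exact WithTop.coe_le_coe.2 le_top)
  have hd : DifferentiableAt ℝ (fderiv ℝ g) q :=
    (hg.fderiv_right (m := ∞) (by simp)).differentiableAt (by simp)
  have key : ∀ a b : Plane, fderiv ℝ (fun y => fderiv ℝ g y a) q b = fderiv ℝ (fderiv ℝ g) q b a :=
    fun a b => by
      have := (hd.hasFDerivAt.clm_apply (hasFDerivAt_const a q)).fderiv
      rw [this]
      simp
  change fderiv ℝ (fun y => fderiv ℝ g y (1, 0)) q (0, 1) =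
    fderiv ℝ (fun y => fderiv ℝ g y (0, 1)) q (1, 0)
  rw [key, key]
  exact hs.eq _ _

/-- A product `v • k(u, v)` with `k` merely continuous is differentiable on the axis `v = 0`. -/
theorem hasFDerivAt_snd_smul {g k : Plane → F} {q : Plane} (hq : q.2 = 0)
    (hk : ContinuousAt k q) (h : ∀ᶠ y in 𝓝 q, g y = y.2 • k y) :
    HasFDerivAt g ((ContinuousLinearMap.snd ℝ ℝ ℝ).smulRight (k q)) q := by
  have hgq : g q = 0 := by rw [h.self_of_nhds, hq, zero_smul]
  rw [hasFDerivAt_iff_isLittleO_nhds_zero]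
  have ht : Tendsto (fun w : Plane => q + w) (𝓝 0) (𝓝 q) := by
    have : ContinuousAt (fun w : Plane => q + w) 0 := by fun_prop
    simpa [ContinuousAt] using this
  have h1 : (fun w : Plane => k (q + w) - k q) =o[𝓝 0] (fun _ => (1 : ℝ)) := by
    rw [Asymptotics.isLittleO_one_iff]
    have := (hk.tendsto.comp ht).sub_const (k q)
    simpa using this
  have h2 : (fun w : Plane => w.2) =O[𝓝 0] (fun w : Plane => ‖w‖) :=
    Asymptotics.isBigO_of_le _ fun w => (norm_snd_le w).trans (le_abs_self _)
  have h3 := h2.smul_isLittleO h1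
  simp only [smul_eq_mul, mul_one] at h3
  refine (h3.congr' ?_ (Eventually.of_forall fun w => rfl)).trans_isBigO ?_
  · filter_upwards [ht.eventually h] with w hw
    rw [hw, hgq]
    simp [hq, smul_sub]
  · refine Asymptotics.isBigO_of_le _ fun w => ?_
    simp

theorem du_snd_smul {g k : Plane → F} {q : Plane} (hq : q.2 = 0)
    (hk : ContinuousAt k q) (h : ∀ᶠ y in 𝓝 q, g y = y.2 • k y) : du g q = 0 := by
  rw [du, (hasFDerivAt_snd_smul hq hk h).fderiv]
  simp

theorem dv_snd_smul {g k : Plane → F} {q : Plane} (hq : q.2 = 0)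
    (hk : ContinuousAt k q) (h : ∀ᶠ y in 𝓝 q, g y = y.2 • k y) : dv g q = k q := by
  rw [dv, (hasFDerivAt_snd_smul hq hk h).fderiv]
  simp

/-- Every germ of a smooth map of the plane is the germ of a globally smooth map. -/
theorem exists_contDiff_eventuallyEq {g : Plane → F} {a : Plane}
    (hg : ∀ᶠ q in 𝓝 a, ContDiffAt ℝ ∞ g q) : ∃ G : Plane → F, ContDiff ℝ ∞ G ∧ G =ᶠ[𝓝 a] g := by
  obtain ⟨ε, hε, hb⟩ := Metric.eventually_nhds_iff_ball.1 hg
  let b : ContDiffBump a := ⟨ε / 4, ε / 2, by positivity, by linarith⟩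
  refine ⟨fun q => b q • g q, contDiff_iff_contDiffAt.2 fun q => ?_, ?_⟩
  · by_cases hq : q ∈ Metric.ball a ε
    · exact b.contDiffAt.smul (hb q hq)
    · have h1 : q ∉ tsupport b := by
        rw [b.tsupport_eq, Metric.mem_closedBall]
        rw [Metric.mem_ball] at hq
        change ¬ dist q a ≤ ε / 2
        linarith
      refine contDiffAt_const (c := (0 : F)) |>.congr_of_eventuallyEq ?_
      filter_upwards [notMem_tsupport_iff_eventuallyEq.1 h1] with y hy
      simp [hy]
  · filter_upwards [b.eventuallyEq_one] with q hq
    simp [hq]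

/-- Differentiation under the integral sign, for integrands smooth in all variables. -/
theorem contDiff_nat_intervalIntegral (n : ℕ) :
    ∀ {F : Type} [NormedAddCommGroup F] [NormedSpace ℝ F] {G : Plane × ℝ → F}, ContDiff ℝ n G →
    ContDiff ℝ n (fun x : Plane => ∫ t in (0 : ℝ)..1, G (x, t)) := by
  induction n with
  | zero =>
    intro F _ _ G hG
    have hG' : Continuous G := hG.continuous
    rw [Nat.cast_zero, contDiff_zero]
    exact intervalIntegral.continuous_parametric_intervalIntegral_of_continuous
      (f := fun x t => G (x, t)) (by exact hG') continuous_const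
  | succ n ih =>
    intro F _ _ G hG
    have hG1 : Continuous G := hG.continuous
    let G' : Plane × ℝ → (Plane →L[ℝ] F) :=
      fun z => (fderiv ℝ G z).comp (ContinuousLinearMap.inl ℝ Plane ℝ)
    have hG' : ContDiff ℝ n G' :=
      (hG.fderiv_right (m := n) (by norm_cast)).clm_comp contDiff_const
    have hc : Continuous G' := hG'.continuous
    push_cast
    rw [contDiff_succ_iff_hasFDerivAt]
    refine ⟨fun x => ∫ t in (0 : ℝ)..1, G' (x, t), ?_, fun x => ?_⟩
    · exact ih hG'
    · have hcomp : IsCompact (Metric.closedBall x 1 ×ˢ Icc (0 : ℝ) 1) :=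
        (isCompact_closedBall x 1).prod isCompact_Icc
      obtain ⟨C, hC⟩ := hcomp.exists_bound_of_continuousOn hc.continuousOn
      refine intervalIntegral.hasFDerivAt_integral_of_dominated_of_fderiv_le
        (F := fun y t => G (y, t)) (F' := fun y t => G' (y, t)) (bound := fun _ => C)
        (s := Metric.closedBall x 1)
        (Metric.closedBall_mem_nhds x one_pos) ?_ ?_ ?_ ?_ ?_ ?_
      · exact Eventually.of_forall fun y =>
          (Continuous.aestronglyMeasurable (by fun_prop))
      · exact Continuous.intervalIntegrable (by fun_prop) _ _
      · exact Continuous.aestronglyMeasurable (by fun_prop)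
      · refine Eventually.of_forall fun t ht y hy => hC (y, t) ⟨hy, ?_⟩
        rw [uIoc_of_le zero_le_one] at ht
        exact ⟨ht.1.le, ht.2⟩
      · exact intervalIntegrable_const
      · refine Eventually.of_forall fun t _ y _ => ?_
        have h1 : HasFDerivAt G (fderiv ℝ G (y, t)) (y, t) :=
          (hG.differentiable (by simp) _).hasFDerivAt
        have h2 : HasFDerivAt (fun y : Plane => (y, t)) (ContinuousLinearMap.inl ℝ Plane ℝ) y :=
          hasFDerivAt_prodMk_left y t
        exact h1.comp y h2

/-- Hadamard's lemma: a smooth germ vanishing on the axis `v = 0` is divisible by `v`. -/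
theorem exists_eq_snd_smul [CompleteSpace F] {g : Plane → F}
    (hg : ∀ᶠ q in 𝓝 (0 : Plane), ContDiffAt ℝ ∞ g q)
    (h0 : ∀ᶠ q in 𝓝 (0 : Plane), q.2 = 0 → g q = 0) :
    ∃ k : Plane → F, ContDiff ℝ ∞ k ∧ ∀ᶠ q in 𝓝 (0 : Plane), g q = q.2 • k q := by
  obtain ⟨G, hG, hGg⟩ := exists_contDiff_eventuallyEq hg
  have hdG := contDiff_dv hG
  refine ⟨fun q => ∫ t in (0 : ℝ)..1, dv G (q.1, t * q.2), ?_, ?_⟩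
  · rw [contDiff_infty]
    intro n
    refine contDiff_nat_intervalIntegral n (G := fun z : Plane × ℝ => dv G (z.1.1, z.2 * z.1.2)) ?_
    exact (hdG.of_le (by exact mod_cast le_top)).comp (by fun_prop)
  · have hp : Tendsto (fun q : Plane => ((q.1, 0) : Plane)) (𝓝 0) (𝓝 0) :=
      Continuous.tendsto' (by fun_prop) _ _ rfl
    filter_upwards [hGg, hp.eventually hGg, hp.eventually h0] with q h1 h2 h3
    have hd : ∀ t : ℝ,
        HasDerivAt (fun t : ℝ => G (q.1, t * q.2)) (q.2 • dv G (q.1, t * q.2)) t := by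
      intro t
      have e1 : HasFDerivAt G (fderiv ℝ G (q.1, t * q.2)) (q.1, t * q.2) :=
        (hG.differentiable (by simp) _).hasFDerivAt
      have e2 : HasDerivAt (fun t : ℝ => ((q.1, t * q.2) : Plane)) (0, q.2) t :=
        (hasDerivAt_const t q.1).prodMk (by simpa using (hasDerivAt_id t).mul_const q.2)
      have e3 := e1.comp_hasDerivAt t e2
      rw [fderiv_apply_eq_du_dv] at e3
      simpa [Function.comp_def] using e3
    have hi := intervalIntegral.integral_eq_sub_of_hasDerivAt (a := 0) (b := 1)
      (fun t _ => hd t)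
      (Continuous.intervalIntegrable (by
        have := hdG.continuous
        fun_prop) _ _)
    rw [intervalIntegral.integral_smul] at hi
    rw [hi, ← h1]
    simp [h2, h3 rfl]

end Calculus

/-! ### The inverse function theorem -/

/-- The inverse function theorem: a smooth map with invertible derivative at `a` restricts to a
partial diffeomorphism around `a`. -/
theorem exists_partialDiffeomorph {E E' : Type*} [NormedAddCommGroup E] [NormedSpace ℝ E]
    [CompleteSpace E] [NormedAddCommGroup E'] [NormedSpace ℝ E'] {g : E → E'} {a : E}
    (hg : ∀ᶠ q in 𝓝 a, ContDiffAt ℝ ∞ g q) {A : E ≃L[ℝ] E'}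
    (hA : HasFDerivAt g (A : E →L[ℝ] E') a) :
    ∃ φ : PartialDiffeomorph 𝓘(ℝ, E) 𝓘(ℝ, E') E E' ∞, a ∈ φ.source ∧ ∀ q, φ q = g q := by
  have ha := hg.self_of_nhds
  let e := ha.toOpenPartialHomeomorph g hA (by simp)
  have hae : a ∈ e.source := ha.mem_toOpenPartialHomeomorph_source hA (by simp)
  have hinv : ∀ᶠ q in 𝓝 a, fderiv ℝ g q ∈ range ((↑) : (E ≃L[ℝ] E') → E →L[ℝ] E') := by
    apply (ha.continuousAt_fderiv (by simp)).eventually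
    rw [hA.fderiv]
    exact A.nhds
  obtain ⟨W, hW, hWo, haW⟩ := eventually_nhds_iff.1 (hg.and hinv)
  let e' := e.restrOpen W hWo
  have hmem : ∀ y ∈ e'.target, e'.symm y ∈ W := fun y hy => (e'.map_target hy).2
  refine ⟨⟨e'.toPartialEquiv, e'.open_source, e'.open_target, ?_, ?_⟩, ⟨hae, haW⟩, fun q => rfl⟩
  · refine ContDiffOn.contMDiffOn fun q hq => ?_
    exact (hW q hq.2).1.contDiffWithinAt
  · refine ContDiffOn.contMDiffOn fun y hy => ?_
    obtain ⟨h1, B, hB⟩ := hW _ (hmem y hy)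
    refine (e'.contDiffAt_symm hy (f₀' := B) ?_ h1).contDiffWithinAt
    rw [hB]
    exact (h1.differentiableAt (by simp)).hasFDerivAt

/-- A linear endomorphism of the plane with non-zero determinant, given by its matrix, is
invertible. -/
theorem exists_equiv_of_det_ne_zero (L : Plane →L[ℝ] Plane)
    (h : (L (1, 0)).1 * (L (0, 1)).2 - (L (0, 1)).1 * (L (1, 0)).2 ≠ 0) :
    ∃ A : Plane ≃L[ℝ] Plane, (A : Plane →L[ℝ] Plane) = L := by
  have hL : ∀ w : Plane, L w = w.1 • L (1, 0) + w.2 • L (0, 1) := by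
    intro w
    rw [← map_smul, ← map_smul, ← map_add]
    congr 1
    ext <;> simp
  have hinj : Function.Injective L := by
    rw [injective_iff_map_eq_zero]
    intro w hw
    rw [hL] at hw
    have h1 := congrArg Prod.fst hw
    have h2 := congrArg Prod.snd hw
    simp only [Prod.fst_add, Prod.snd_add, Prod.smul_fst, Prod.smul_snd, smul_eq_mul,
      Prod.fst_zero, Prod.snd_zero] at h1 h2
    apply Prod.ext
    · apply (mul_eq_zero.1 (_ : w.1 * _ = 0)).resolve_right h
      linear_combination (L (0, 1)).2 * h1 - (L (0, 1)).1 * h2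
    · apply (mul_eq_zero.1 (_ : w.2 * _ = 0)).resolve_right h
      linear_combination (L (1, 0)).1 * h2 - (L (1, 0)).2 * h1
  refine ⟨(LinearEquiv.ofInjectiveEndo L.toLinearMap hinj).toContinuousLinearEquiv, ?_⟩
  ext <;> simp

/-! ### The normal form of a fold of the plane -/

/-- The Jacobian determinant of the map `(g₁, g₂)` of the plane. -/
def jacobian (g₁ g₂ : Plane → ℝ) (q : Plane) : ℝ := du g₁ q * dv g₂ q - du g₂ q * dv g₁ q

/-- The inverse function theorem for a map of the plane given by its components. -/
theorem exists_partialDiffeomorph_plane {g₁ g₂ : Plane → ℝ} {a : Plane}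
    (h₁ : ∀ᶠ q in 𝓝 a, ContDiffAt ℝ ∞ g₁ q) (h₂ : ∀ᶠ q in 𝓝 a, ContDiffAt ℝ ∞ g₂ q)
    (hJ : jacobian g₁ g₂ a ≠ 0) :
    ∃ φ : PartialDiffeomorph 𝓘(ℝ, Plane) 𝓘(ℝ, Plane) Plane Plane ∞,
      a ∈ φ.source ∧ ∀ q, φ q = (g₁ q, g₂ q) := by
  have d₁ := (h₁.self_of_nhds.differentiableAt (by simp)).hasFDerivAt
  have d₂ := (h₂.self_of_nhds.differentiableAt (by simp)).hasFDerivAt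
  obtain ⟨A, hA⟩ := exists_equiv_of_det_ne_zero ((fderiv ℝ g₁ a).prod (fderiv ℝ g₂ a)) (by
    simp only [ContinuousLinearMap.prod_apply]
    intro h
    apply hJ
    simp only [jacobian, du, dv]
    linarith)
  refine exists_partialDiffeomorph (g := fun q => (g₁ q, g₂ q)) (A := A) ?_ ?_
  · filter_upwards [h₁, h₂] with q e₁ e₂ using e₁.prodMk e₂
  · rw [hA]
    exact d₁.prodMk d₂

theorem du_snd (q : Plane) : du (fun y : Plane => y.2) q = 0 := by
  simp [du, (hasFDerivAt_snd (𝕜 := ℝ) (p := q)).fderiv]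

theorem dv_snd (q : Plane) : dv (fun y : Plane => y.2) q = 1 := by
  simp [dv, (hasFDerivAt_snd (𝕜 := ℝ) (p := q)).fderiv]

theorem du_dv_sub_comp {g₁ g₂ : Plane → ℝ} {c : ℝ → ℝ} {q : Plane} (h₁ : DifferentiableAt ℝ g₁ q)
    (h₂ : DifferentiableAt ℝ g₂ q) (hc : DifferentiableAt ℝ c (g₁ q)) :
    du (fun y => g₂ y - c (g₁ y)) q = du g₂ q - deriv c (g₁ q) * du g₁ q ∧
    dv (fun y => g₂ y - c (g₁ y)) q = dv g₂ q - deriv c (g₁ q) * dv g₁ q := by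
  have h := h₂.hasFDerivAt.sub (hc.hasDerivAt.comp_hasFDerivAt q h₁.hasFDerivAt)
  have e : fderiv ℝ (fun y => g₂ y - c (g₁ y)) q = fderiv ℝ g₂ q - deriv c (g₁ q) • fderiv ℝ g₁ q :=
    h.fderiv
  simp [du, dv, e]

theorem du_dv_snd_sq_mul {k : Plane → ℝ} {q : Plane} (hk : DifferentiableAt ℝ k q) :
    du (fun y : Plane => y.2 ^ 2 * k y) q = q.2 ^ 2 * du k q ∧
    dv (fun y : Plane => y.2 ^ 2 * k y) q = 2 * q.2 * k q + q.2 ^ 2 * dv k q := by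
  have h := ((hasFDerivAt_snd (𝕜 := ℝ) (p := q)).pow 2).mul hk.hasFDerivAt
  have e := h.fderiv
  have e' : fderiv ℝ (fun y : Plane => y.2 ^ 2 * k y) q = _ := e
  constructor
  · simp [du, e']
  · simp only [dv, e']
    simp
    ring

/-- The normal form of a fold: a map of the plane whose Jacobian determinant vanishes to first order
along the axis `v = 0`, and whose kernel is transverse to the axis in the sense that `∂g₁/∂u ≠ 0`,
is `(u, v) ↦ (u, v²)` in suitable coordinates of the source and the target. -/
theorem exists_fold_normal_form {g₁ g₂ : Plane → ℝ} (hg₁ : ContDiff ℝ ∞ g₁)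
    (hg₂ : ContDiff ℝ ∞ g₂) (h₁0 : g₁ 0 = 0) (hu : du g₁ 0 ≠ 0)
    (hJ0 : ∀ᶠ q in 𝓝 (0 : Plane), q.2 = 0 → jacobian g₁ g₂ q = 0)
    (hJ : dv (jacobian g₁ g₂) 0 ≠ 0) :
    ∃ (φ : PartialDiffeomorph 𝓘(ℝ, Plane) 𝓘(ℝ, Plane) Plane Plane ∞)
      (Φ : PartialDiffeomorph 𝓘(ℝ, Plane) 𝓘(ℝ, Plane) Plane Plane ∞),
      0 ∈ φ.source ∧ φ 0 = 0 ∧ 0 ∈ Φ.source ∧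
        ∀ᶠ q in 𝓝 (0 : Plane), Φ (g₁ q, g₂ q) = ((φ q).1, (φ q).2 ^ 2) := by
  have s₁ : ∀ q, ContDiffAt ℝ ∞ g₁ q := contDiff_iff_contDiffAt.1 hg₁
  have s₂ : ∀ q, ContDiffAt ℝ ∞ g₂ q := contDiff_iff_contDiffAt.1 hg₂
  have d₁ : ∀ q, DifferentiableAt ℝ g₁ q := fun q => hg₁.differentiable (by simp) q
  have d₂ : ∀ q, DifferentiableAt ℝ g₂ q := fun q => hg₂.differentiable (by simp) q
  have hsnd : ContDiff ℝ ∞ (fun q : Plane => q.2) := contDiff_snd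
  -- The critical values form the graph of `c`, because `(g₁, v)` are coordinates of the source.
  obtain ⟨θ, hθ0, hθ⟩ := exists_partialDiffeomorph_plane (a := 0) (Eventually.of_forall s₁)
    (Eventually.of_forall fun q => hsnd.contDiffAt) (by
      rw [jacobian, du_snd, dv_snd]
      simpa using hu)
  have hθ00 : θ 0 = 0 := by rw [hθ, h₁0]; rfl
  have hT0 : (0 : Plane) ∈ θ.target := by
    have := θ.map_source hθ0
    rwa [show θ.toPartialEquiv 0 = (0 : Plane) from hθ00] at this
  let c : ℝ → ℝ := fun a => g₂ (θ.symm (a, 0))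
  have hax : Tendsto (fun a : ℝ => ((a, 0) : Plane)) (𝓝 0) (𝓝 0) :=
    Continuous.tendsto' (by fun_prop) _ _ rfl
  have hc : ∀ᶠ a in 𝓝 (0 : ℝ), ContDiffAt ℝ ∞ c a := by
    filter_upwards [hax.eventually (θ.open_target.mem_nhds hT0)] with a ha
    have h1 : ContDiffAt ℝ ∞ θ.symm (a, 0) :=
      θ.contMDiffOn_invFun.contDiffOn.contDiffAt (θ.open_target.mem_nhds ha)
    have h2 : ContDiffAt ℝ ∞ (fun a : ℝ => ((a, 0) : Plane)) a := by fun_prop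
    exact (s₂ _).comp a (h1.comp a h2)
  have hcg : ∀ᶠ q in 𝓝 (0 : Plane), q.2 = 0 → c (g₁ q) = g₂ q := by
    filter_upwards [θ.open_source.mem_nhds hθ0] with q hq hq2
    have : ((g₁ q, 0) : Plane) = θ q := by rw [hθ, hq2]
    simp only [c]
    rw [this]
    exact congrArg g₂ (θ.left_inv hq)
  have ht₁ : Tendsto g₁ (𝓝 0) (𝓝 0) := by
    have := hg₁.continuous.tendsto 0
    rwa [h₁0] at this
  have hcq : ∀ᶠ q in 𝓝 (0 : Plane), ContDiffAt ℝ ∞ c (g₁ q) := ht₁.eventually hc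
  let r : Plane → ℝ := fun q => g₂ q - c (g₁ q)
  have hr : ∀ᶠ q in 𝓝 (0 : Plane), ContDiffAt ℝ ∞ r q := by
    filter_upwards [hcq] with q hq using (s₂ q).sub (hq.comp q (s₁ q))
  obtain ⟨k₁, hk₁, hrk₁⟩ := exists_eq_snd_smul hr (by
    filter_upwards [hcg] with q hq hq2
    simp [r, hq hq2])
  have hdr : ∀ᶠ q in 𝓝 (0 : Plane), du r q = du g₂ q - deriv c (g₁ q) * du g₁ q ∧
      dv r q = dv g₂ q - deriv c (g₁ q) * dv g₁ q := by
    filter_upwards [hcq] with q hq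
    exact du_dv_sub_comp (d₁ q) (d₂ q) (hq.differentiableAt (by simp))
  have hJr : ∀ᶠ q in 𝓝 (0 : Plane), jacobian g₁ g₂ q = du g₁ q * dv r q - du r q * dv g₁ q := by
    filter_upwards [hdr] with q hq
    rw [hq.1, hq.2, jacobian]
    ring
  -- On the axis `∂r/∂v` vanishes together with the Jacobian determinant.
  obtain ⟨k, hk, hk₁k⟩ := exists_eq_snd_smul
    (Eventually.of_forall fun q => contDiff_iff_contDiffAt.1 hk₁ q) (by
      have hne : ∀ᶠ q in 𝓝 (0 : Plane), du g₁ q ≠ 0 :=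
        (contDiff_du hg₁).continuous.continuousAt.eventually_ne hu
      filter_upwards [hJr, hJ0, hrk₁.eventually_nhds, hne] with q e1 e2 e3 e4 hq
      have f1 := du_snd_smul hq hk₁.continuous.continuousAt e3
      have f2 := dv_snd_smul hq hk₁.continuous.continuousAt e3
      rw [e2 hq, f1, f2, zero_mul, sub_zero] at e1
      exact (mul_eq_zero.1 e1.symm).resolve_left e4)
  have hrk : ∀ᶠ q in 𝓝 (0 : Plane), r q = q.2 ^ 2 * k q := by
    filter_upwards [hrk₁, hk₁k] with q e1 e2
    rw [e1, e2]
    simp only [smul_eq_mul]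
    ring
  have hk0 : k 0 ≠ 0 := by
    intro h0
    apply hJ
    have hJk : ∀ᶠ q in 𝓝 (0 : Plane), jacobian g₁ g₂ q =
        q.2 • (du g₁ q * (2 * k q + q.2 * dv k q) - q.2 * du k q * dv g₁ q) := by
      filter_upwards [hJr, hrk.eventually_nhds] with q e1 e2
      have e2' : r =ᶠ[𝓝 q] fun y : Plane => y.2 ^ 2 * k y := e2
      obtain ⟨f1, f2⟩ := du_dv_snd_sq_mul (hk.differentiable (by simp) q)
      rw [e1, (du_congr e2').eq_of_nhds, (dv_congr e2').eq_of_nhds, f1, f2, smul_eq_mul]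
      ring
    have hcont : Continuous fun q : Plane =>
        du g₁ q * (2 * k q + q.2 * dv k q) - q.2 * du k q * dv g₁ q := by
      have := (contDiff_du hg₁).continuous
      have := (contDiff_dv hg₁).continuous
      have := (contDiff_du hk).continuous
      have := (contDiff_dv hk).continuous
      have := hk.continuous
      fun_prop
    rw [dv_snd_smul rfl hcont.continuousAt hJk]
    simp [h0]
  -- Multiplication by `ε` makes the factor `k` positive, so that it has a smooth square root.
  obtain ⟨ε, hε, hεk⟩ : ∃ ε : ℝ, ε ≠ 0 ∧ 0 < ε * k 0 := ⟨k 0, hk0, mul_self_pos.2 hk0⟩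
  have hpos : ∀ᶠ q in 𝓝 (0 : Plane), 0 < ε * k q :=
    (continuous_const.mul hk.continuous).continuousAt.eventually (lt_mem_nhds hεk)
  let w : Plane → ℝ := fun q => √(ε * k q)
  have hw : ∀ᶠ q in 𝓝 (0 : Plane), ContDiffAt ℝ ∞ w q := by
    filter_upwards [hpos] with q hq
    exact (contDiffAt_const.mul hk.contDiffAt).sqrt hq.ne'
  have hρ : ∀ᶠ q in 𝓝 (0 : Plane), ContDiffAt ℝ ∞ (fun q : Plane => q.2 • w q) q := by
    filter_upwards [hw] with q hq using hsnd.contDiffAt.smul hq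
  obtain ⟨φ, hφ0, hφ⟩ := exists_partialDiffeomorph_plane (a := 0) (Eventually.of_forall s₁) hρ (by
    have hwc := hw.self_of_nhds.continuousAt
    rw [jacobian, du_snd_smul rfl hwc (Eventually.of_forall fun q => rfl),
      dv_snd_smul rfl hwc (Eventually.of_forall fun q => rfl), zero_mul, sub_zero]
    exact mul_ne_zero hu (Real.sqrt_pos.2 hεk).ne')
  have hfst : ContDiff ℝ ∞ (fun q : Plane => q.1) := contDiff_fst
  have htf : Tendsto (fun q : Plane => q.1) (𝓝 0) (𝓝 0) := Continuous.tendsto' (by fun_prop) _ _ rfl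
  have hT : ∀ᶠ z in 𝓝 (0 : Plane), ContDiffAt ℝ ∞ (fun z : Plane => ε * (z.2 - c z.1)) z := by
    filter_upwards [htf.eventually hc] with z hz
    exact contDiffAt_const.mul (hsnd.contDiffAt.sub (hz.comp z hfst.contDiffAt))
  obtain ⟨Φ, hΦ0, hΦ⟩ := exists_partialDiffeomorph_plane (a := 0)
    (Eventually.of_forall fun q => hfst.contDiffAt) hT (by
      have h1 := hfst.differentiable (by simp) 0
      have h2 := hsnd.differentiable (by simp) 0
      have h3 := hc.self_of_nhds.differentiableAt (by simp)
      have h4 : DifferentiableAt ℝ (fun z : Plane => z.2 - c z.1) 0 := 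
        h2.sub (DifferentiableAt.comp (g := c) (f := fun q : Plane => q.1) (0 : Plane) h3 h1)
      have e : ∀ a : Plane, fderiv ℝ (fun z : Plane => ε * (z.2 - c z.1)) 0 a =
          ε * fderiv ℝ (fun z : Plane => z.2 - c z.1) 0 a := fun a => by
        rw [fderiv_const_mul h4]
        rfl
      have f := du_dv_sub_comp h1 h2 h3
      have g1 : du (fun z : Plane => z.1) 0 = 1 := by
        simp [du, (hasFDerivAt_fst (𝕜 := ℝ) (p := (0 : Plane))).fderiv]
      have g2 : dv (fun z : Plane => z.1) 0 = 0 := by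
        simp [dv, (hasFDerivAt_fst (𝕜 := ℝ) (p := (0 : Plane))).fderiv]
      have e1 : dv (fun z : Plane => ε * (z.2 - c z.1)) 0 = ε := by
        change fderiv ℝ _ 0 _ = _
        rw [e]
        change ε * dv _ 0 = ε
        rw [f.2, g2, dv_snd]
        ring
      rw [jacobian, g1, g2, e1]
      simpa using hε)
  refine ⟨φ, Φ, hφ0, by rw [hφ, h₁0]; simp, hΦ0, ?_⟩
  filter_upwards [hrk, hpos] with q e1 e2
  rw [hΦ, hφ]
  refine Prod.ext rfl ?_
  change ε * r q = (q.2 * √(ε * k q)) ^ 2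
  rw [mul_pow, Real.sq_sqrt e2.le, e1]
  ring

/-- The normal form of a fold, when only `(∂g₁/∂u, ∂g₂/∂u) ≠ 0` is known. -/
theorem exists_fold_normal_form_of_or {g₁ g₂ : Plane → ℝ} (hg₁ : ContDiff ℝ ∞ g₁)
    (hg₂ : ContDiff ℝ ∞ g₂) (h₁0 : g₁ 0 = 0) (h₂0 : g₂ 0 = 0) (hu : du g₁ 0 ≠ 0 ∨ du g₂ 0 ≠ 0)
    (hJ0 : ∀ᶠ q in 𝓝 (0 : Plane), q.2 = 0 → jacobian g₁ g₂ q = 0)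
    (hJ : dv (jacobian g₁ g₂) 0 ≠ 0) :
    ∃ (φ : PartialDiffeomorph 𝓘(ℝ, Plane) 𝓘(ℝ, Plane) Plane Plane ∞)
      (Φ : PartialDiffeomorph 𝓘(ℝ, Plane) 𝓘(ℝ, Plane) Plane Plane ∞),
      0 ∈ φ.source ∧ φ 0 = 0 ∧ 0 ∈ Φ.source ∧
        ∀ᶠ q in 𝓝 (0 : Plane), Φ (g₁ q, g₂ q) = ((φ q).1, (φ q).2 ^ 2) := by
  rcases hu with hu | hu
  · exact exists_fold_normal_form hg₁ hg₂ h₁0 hu hJ0 hJ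
  · have hneg : jacobian g₂ g₁ = fun q => -jacobian g₁ g₂ q := by
      funext q
      simp only [jacobian]
      ring
    obtain ⟨φ, Φ, h1, h2, h3, h4⟩ := exists_fold_normal_form hg₂ hg₁ h₂0 hu
      (by
        filter_upwards [hJ0] with q hq hq2
        rw [hneg]
        simp [hq hq2])
      (by
        have e : dv (fun q => -jacobian g₁ g₂ q) 0 = -dv (jacobian g₁ g₂) 0 := by
          rw [dv, dv, fderiv_fun_neg]
          rfl
        rw [hneg, e]
        exact neg_ne_zero.2 hJ)
    exact ⟨φ, (ContinuousLinearEquiv.prodComm ℝ ℝ ℝ).toDiffeomorph.toPartialDiffeomorph.trans Φ,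
      h1, h2, ⟨trivial, h3⟩, h4⟩

/-! ### Determinants and inner products in 3-space -/

theorem inner_eq_sum (a b : E3) : inner ℝ a b = a 0 * b 0 + a 1 * b 1 + a 2 * b 2 := by
  simp [PiLp.inner_apply, Fin.sum_univ_three, mul_comm]

theorem det3_eq (a b c : E3) : det3 a b c =
    a 0 * b 1 * c 2 - a 0 * b 2 * c 1 - a 1 * b 0 * c 2 + a 1 * b 2 * c 0 + a 2 * b 0 * c 1 -
      a 2 * b 1 * c 0 := by
  simp [det3, Matrix.det_fin_three]

/-- The product of two determinants is the determinant of the matrix of inner products. -/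
theorem det3_mul_det3 (a b c a' b' c' : E3) : det3 a b c * det3 a' b' c' =
    inner ℝ a a' * (inner ℝ b b' * inner ℝ c c' - inner ℝ b c' * inner ℝ c b') -
    inner ℝ a b' * (inner ℝ b a' * inner ℝ c c' - inner ℝ b c' * inner ℝ c a') +
    inner ℝ a c' * (inner ℝ b a' * inner ℝ c b' - inner ℝ b b' * inner ℝ c a') := by
  simp only [det3_eq, inner_eq_sum]
  ring

/-- A vector orthogonal to three linearly independent ones vanishes. -/
theorem eq_zero_of_inner_eq_zero {a b c w : E3} (h : det3 a b c ≠ 0) (ha : inner ℝ a w = 0)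
    (hb : inner ℝ b w = 0) (hc : inner ℝ c w = 0) : w = 0 := by
  rw [inner_eq_sum] at ha hb hc
  rw [det3_eq] at h
  ext i
  fin_cases i
  · apply (mul_eq_zero.1 (_ : _ * w 0 = 0)).resolve_left h
    linear_combination (b 1 * c 2 - b 2 * c 1) * ha - (a 1 * c 2 - a 2 * c 1) * hb +
      (a 1 * b 2 - a 2 * b 1) * hc
  · apply (mul_eq_zero.1 (_ : _ * w 1 = 0)).resolve_left h
    linear_combination -(b 0 * c 2 - b 2 * c 0) * ha + (a 0 * c 2 - a 2 * c 0) * hb -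
      (a 0 * b 2 - a 2 * b 0) * hc
  · apply (mul_eq_zero.1 (_ : _ * w 2 = 0)).resolve_left h
    linear_combination (b 0 * c 1 - b 1 * c 0) * ha - (a 0 * c 1 - a 1 * c 0) * hb +
      (a 0 * b 1 - a 1 * b 0) * hc

theorem norm_cross_sq (a b : E3) :
    ‖cross a b‖ ^ 2 = inner ℝ a a * inner ℝ b b - inner ℝ a b ^ 2 := by
  rw [← real_inner_self_eq_norm_sq]
  simp only [inner_eq_sum, cross, crossProduct]
  simp
  ring

theorem det3_smul_right (t : ℝ) (a b c : E3) : det3 a (t • b) c = t * det3 a b c := by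
  simp only [det3_eq, PiLp.smul_apply, smul_eq_mul]
  ring

/-- The Gram determinant of two linearly independent vectors is positive. -/
theorem gram_pos {a b : E3} (h : ∀ s t : ℝ, s • a + t • b = 0 → s = 0 ∧ t = 0) :
    0 < inner ℝ a a * inner ℝ b b - inner ℝ a b ^ 2 := by
  rw [← norm_cross_sq]
  refine (sq_nonneg _).lt_of_ne' fun h0 => ?_
  have h1 : inner ℝ a a * inner ℝ b b - inner ℝ a b ^ 2 = (0 : ℝ) := by rw [← norm_cross_sq, h0]
  -- `w = ⟨b, b⟩ a - ⟨a, b⟩ b` has square length `⟨b, b⟩` times the Gram determinant.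
  have h2 : inner ℝ (inner ℝ b b • a + (-inner ℝ a b : ℝ) • b)
      (inner ℝ b b • a + (-inner ℝ a b : ℝ) • b) = (0 : ℝ) := by
    have : inner ℝ (inner ℝ b b • a + (-inner ℝ a b : ℝ) • b)
        (inner ℝ b b • a + (-inner ℝ a b : ℝ) • b) =
        inner ℝ b b * (inner ℝ a a * inner ℝ b b - inner ℝ a b ^ 2) := by
      simp only [inner_add_left, inner_add_right, real_inner_smul_left, real_inner_smul_right,
        real_inner_comm a b]
      ring
    rw [this, h1, mul_zero]
  have hb := (h _ _ (inner_self_eq_zero.1 h2)).1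
  have hb0 : b = 0 := inner_self_eq_zero.1 hb
  have := (h 0 1 (by simp [hb0])).2
  norm_num at this

/-! ### Fronts in adapted coordinates -/

theorem du_inner {a b : Plane → E3} {q : Plane} (ha : DifferentiableAt ℝ a q)
    (hb : DifferentiableAt ℝ b q) :
    du (fun y => inner ℝ (a y) (b y)) q = inner ℝ (a q) (du b q) + inner ℝ (du a q) (b q) :=
  fderiv_inner_apply ℝ ha hb _

theorem dv_inner {a b : Plane → E3} {q : Plane} (ha : DifferentiableAt ℝ a q)
    (hb : DifferentiableAt ℝ b q) :
    dv (fun y => inner ℝ (a y) (b y)) q = inner ℝ (a q) (dv b q) + inner ℝ (dv a q) (b q) :=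
  fderiv_inner_apply ℝ ha hb _

theorem du_eq_zero_of_eventually_const {g : Plane → ℝ} {q : Plane} {c : ℝ}
    (h : ∀ᶠ y in 𝓝 q, g y = c) : du g q = 0 := by
  have h' : g =ᶠ[𝓝 q] fun _ => c := h
  rw [du, h'.fderiv_eq]
  simp

theorem dv_eq_zero_of_eventually_const {g : Plane → ℝ} {q : Plane} {c : ℝ}
    (h : ∀ᶠ y in 𝓝 q, g y = c) : dv g q = 0 := by
  have h' : g =ᶠ[𝓝 q] fun _ => c := h
  rw [dv, h'.fderiv_eq]
  simp

/-- The second fundamental form is symmetric. -/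
theorem inner_du_dv_symm {f n : Plane → E3} {q : Plane} (hf : ContDiffAt ℝ ∞ f q)
    (hn : ContDiffAt ℝ ∞ n q) (hu : ∀ᶠ y in 𝓝 q, inner ℝ (du f y) (n y) = 0)
    (hv : ∀ᶠ y in 𝓝 q, inner ℝ (dv f y) (n y) = 0) :
    inner ℝ (du f q) (dv n q) = inner ℝ (dv f q) (du n q) := by
  have hn' := hn.differentiableAt (by simp)
  have h1 := dv_eq_zero_of_eventually_const hu
  have h2 := du_eq_zero_of_eventually_const hv
  rw [dv_inner ((contDiffAt_du hf).differentiableAt (by simp)) hn', dv_du_comm hf] at h1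
  rw [du_inner ((contDiffAt_dv hf).differentiableAt (by simp)) hn'] at h2
  linarith

/-- The germ at the origin of a front `F` with unit normal `n` in adapted coordinates:
`F_v = v h`, where `F_u` and `h` are linearly independent at the origin (their Gram determinant is
positive). The germs are represented by globally smooth maps, and the conditions on them hold near
the origin only. -/
structure IsEdgeGerm (F n h : Plane → E3) : Prop where
  smooth : ContDiff ℝ ∞ F
  smooth_normal : ContDiff ℝ ∞ n
  smooth_factor : ContDiff ℝ ∞ h
  unit : ∀ᶠ q in 𝓝 (0 : Plane), inner ℝ (n q) (n q) = (1 : ℝ)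
  ortho_du : ∀ᶠ q in 𝓝 (0 : Plane), inner ℝ (du F q) (n q) = 0
  ortho_dv : ∀ᶠ q in 𝓝 (0 : Plane), inner ℝ (dv F q) (n q) = 0
  dv_eq : ∀ᶠ q in 𝓝 (0 : Plane), dv F q = q.2 • h q
  indep : 0 < inner ℝ (du F 0) (du F 0) * inner ℝ (h 0) (h 0) - inner ℝ (du F 0) (h 0) ^ 2
  immersion : dv n 0 ≠ 0

/-- The coefficient `M / v` of the second fundamental form. -/
def hatM (n h : Plane → E3) (q : Plane) : ℝ := -inner ℝ (h q) (du n q)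

/-- The coefficient `N / v` of the second fundamental form. -/
def hatN (n h : Plane → E3) (q : Plane) : ℝ := -inner ℝ (h q) (dv n q)

/-- The determinant `(EG - F²) / v²` of the first fundamental form. -/
def hatD (F h : Plane → E3) (q : Plane) : ℝ :=
  inner ℝ (du F q) (du F q) * inner ℝ (h q) (h q) - inner ℝ (du F q) (h q) ^ 2

/-- The determinant `(LN - M²) / v²` of the second fundamental form, where `l = L / v`. -/
def hatC (n h : Plane → E3) (l : Plane → ℝ) (q : Plane) : ℝ :=
  l q * hatN n h q - hatM n h q ^ 2

/-- The numerator `(EN - 2FM + GL) / v` in the formula for the mean curvature, where `l = L / v`. -/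
def hatB (F n h : Plane → E3) (l : Plane → ℝ) (q : Plane) : ℝ :=
  inner ℝ (du F q) (du F q) * hatN n h q - 2 * q.2 * inner ℝ (du F q) (h q) * hatM n h q +
    q.2 ^ 2 * inner ℝ (h q) (h q) * l q

namespace IsEdgeGerm

variable {F n h : Plane → E3}

section Basic

theorem contDiff_hatM (G : IsEdgeGerm F n h) : ContDiff ℝ ∞ (hatM n h) :=
  (G.smooth_factor.inner ℝ (contDiff_du G.smooth_normal)).neg

theorem contDiff_hatN (G : IsEdgeGerm F n h) : ContDiff ℝ ∞ (hatN n h) :=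
  (G.smooth_factor.inner ℝ (contDiff_dv G.smooth_normal)).neg

theorem contDiff_formL (G : IsEdgeGerm F n h) : ContDiff ℝ ∞ (formL F n) :=
  ((contDiff_du G.smooth).inner ℝ (contDiff_du G.smooth_normal)).neg

theorem contDiff_hatD (G : IsEdgeGerm F n h) : ContDiff ℝ ∞ (hatD F h) :=
  (((contDiff_du G.smooth).inner ℝ (contDiff_du G.smooth)).mul
    (G.smooth_factor.inner ℝ G.smooth_factor)).sub
    (((contDiff_du G.smooth).inner ℝ G.smooth_factor).pow 2)

theorem contDiff_hatC (G : IsEdgeGerm F n h) {l : Plane → ℝ} (hl : ContDiff ℝ ∞ l) :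
    ContDiff ℝ ∞ (hatC n h l) :=
  (hl.mul G.contDiff_hatN).sub (G.contDiff_hatM.pow 2)

theorem contDiff_hatB (G : IsEdgeGerm F n h) {l : Plane → ℝ} (hl : ContDiff ℝ ∞ l) :
    ContDiff ℝ ∞ (hatB F n h l) := by
  have h1 := (contDiff_du G.smooth).inner ℝ (contDiff_du G.smooth)
  have h2 := (contDiff_du G.smooth).inner ℝ G.smooth_factor
  have h3 := G.smooth_factor.inner ℝ G.smooth_factor
  have h4 := G.contDiff_hatM
  have h5 := G.contDiff_hatN
  have h6 : ContDiff ℝ ∞ (fun q : Plane => q.2) := contDiff_snd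
  exact ((h1.mul h5).sub (((contDiff_const.mul h6).mul h2).mul h4)).add (((h6.pow 2).mul h3).mul hl)

theorem formM_eq (G : IsEdgeGerm F n h) :
    ∀ᶠ q in 𝓝 (0 : Plane), formM F n q = q.2 * hatM n h q := by
  filter_upwards [G.dv_eq] with q hq
  rw [formM, hatM, hq, real_inner_smul_left]
  ring

theorem formN_eq (G : IsEdgeGerm F n h) :
    ∀ᶠ q in 𝓝 (0 : Plane), formN F n q = q.2 * hatN n h q := by
  filter_upwards [G.dv_eq] with q hq
  rw [formN, hatN, hq, real_inner_smul_left]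
  ring

theorem inner_du_dv (G : IsEdgeGerm F n h) :
    ∀ᶠ q in 𝓝 (0 : Plane), inner ℝ (du F q) (dv n q) = -(q.2 * hatM n h q) := by
  filter_upwards [G.formM_eq, G.ortho_du.eventually_nhds, G.ortho_dv.eventually_nhds]
    with q h1 h2 h3
  rw [inner_du_dv_symm G.smooth.contDiffAt G.smooth_normal.contDiffAt h2 h3, ← h1, formM, neg_neg]

theorem inner_factor_normal (G : IsEdgeGerm F n h) :
    ∀ᶠ q in 𝓝 (0 : Plane), inner ℝ (h q) (n q) = (0 : ℝ) := by
  have hc := (G.smooth_factor.inner ℝ G.smooth_normal).continuous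
  refine eventually_eq_of_off_axis hc continuous_const ?_
  filter_upwards [G.ortho_dv, G.dv_eq] with q h1 h2 hq
  rw [h2, real_inner_smul_left] at h1
  exact (mul_eq_zero.1 h1).resolve_left hq

theorem inner_normal_du (G : IsEdgeGerm F n h) :
    ∀ᶠ q in 𝓝 (0 : Plane), inner ℝ (n q) (du n q) = (0 : ℝ) := by
  filter_upwards [G.unit.eventually_nhds] with q hq
  have hd := G.smooth_normal.differentiable (by simp) q
  have h1 := du_eq_zero_of_eventually_const hq
  rw [du_inner hd hd, real_inner_comm (n q) (du n q)] at h1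
  linarith

theorem inner_normal_dv (G : IsEdgeGerm F n h) :
    ∀ᶠ q in 𝓝 (0 : Plane), inner ℝ (n q) (dv n q) = (0 : ℝ) := by
  filter_upwards [G.unit.eventually_nhds] with q hq
  have hd := G.smooth_normal.differentiable (by simp) q
  have h1 := dv_eq_zero_of_eventually_const hq
  rw [dv_inner hd hd, real_inner_comm (n q) (dv n q)] at h1
  linarith

theorem hatD_pos (G : IsEdgeGerm F n h) : ∀ᶠ q in 𝓝 (0 : Plane), 0 < hatD F h q :=
  G.contDiff_hatD.continuous.continuousAt.eventually (lt_mem_nhds G.indep)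

theorem det3_ne_zero (G : IsEdgeGerm F n h) :
    ∀ᶠ q in 𝓝 (0 : Plane), det3 (du F q) (h q) (n q) ≠ 0 := by
  filter_upwards [G.hatD_pos, G.unit, G.ortho_du, G.inner_factor_normal] with q h1 h2 h3 h4 h0
  have := det3_mul_det3 (du F q) (h q) (n q) (du F q) (h q) (n q)
  rw [h0, h2, h3, h4, real_inner_comm (du F q) (h q)] at this
  have e : hatD F h q = 0 := by
    rw [hatD]
    linarith
  exact h1.ne' e

theorem inner_du_self_pos (G : IsEdgeGerm F n h) : 0 < inner ℝ (du F 0) (du F 0) := by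
  refine lt_of_le_of_ne real_inner_self_nonneg fun h0 => ?_
  have := G.indep
  rw [← h0] at this
  nlinarith [sq_nonneg (inner ℝ (du F 0) (h 0))]

/-- The immersion condition says that `N / v` does not vanish. -/
theorem hatN_ne_zero (G : IsEdgeGerm F n h) : hatN n h 0 ≠ 0 := by
  intro h0
  apply G.immersion
  refine eq_zero_of_inner_eq_zero G.det3_ne_zero.self_of_nhds ?_ ?_ ?_
  · rw [G.inner_du_dv.self_of_nhds]
    simp
  · simpa [hatN] using h0
  · exact G.inner_normal_dv.self_of_nhds

theorem gaussCurv_eq (G : IsEdgeGerm F n h) : ∀ᶠ q in 𝓝 (0 : Plane), q.2 ≠ 0 →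
    gaussCurv F n q * (q.2 * hatD F h q) = formL F n q * hatN n h q - q.2 * hatM n h q ^ 2 := by
  filter_upwards [G.hatD_pos, G.formM_eq, G.formN_eq, G.dv_eq] with q h1 h2 h3 h4 hq
  have hE : formE F q * formG F q - formF F q ^ 2 = q.2 ^ 2 * hatD F h q := by
    simp only [formE, formF, formG, h4, real_inner_smul_left, real_inner_smul_right, hatD]
    ring
  rw [gaussCurv, hE, h2, h3]
  field_simp

/-- Boundedness of the Gaussian curvature forces the coefficient `L` to vanish along the
singular curve. -/
theorem formL_eq_zero (G : IsEdgeGerm F n h) {C : ℝ}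
    (hC : ∀ᶠ q in 𝓝 (0 : Plane), q.2 ≠ 0 → |gaussCurv F n q| ≤ C) :
    ∀ᶠ q in 𝓝 (0 : Plane), q.2 = 0 → formL F n q = 0 := by
  have hN : ∀ᶠ q in 𝓝 (0 : Plane), hatN n h q ≠ 0 :=
    G.contDiff_hatN.continuous.continuousAt.eventually_ne G.hatN_ne_zero
  -- `|L N̂| ≤ |v| (C D̂ + M̂²)` off the axis, hence by continuity on the axis.
  have hle : ∀ᶠ q in 𝓝 (0 : Plane), q.2 ≠ 0 →
      max |formL F n q * hatN n h q| (|q.2| * (C * hatD F h q + hatM n h q ^ 2)) =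
        |q.2| * (C * hatD F h q + hatM n h q ^ 2) := by
    filter_upwards [hC, G.gaussCurv_eq, G.hatD_pos] with q h1 h2 h3 hq
    apply max_eq_right
    have e : formL F n q * hatN n h q =
        q.2 * (gaussCurv F n q * hatD F h q + hatM n h q ^ 2) := by
      linear_combination -(h2 hq)
    rw [e, abs_mul]
    refine mul_le_mul_of_nonneg_left ((abs_add_le _ _).trans ?_) (abs_nonneg _)
    rw [abs_mul, abs_of_pos h3, abs_of_nonneg (sq_nonneg (hatM n h q))]
    have := mul_le_mul_of_nonneg_right (h1 hq) h3.le
    linarith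
  have c1 := G.contDiff_formL.continuous
  have c2 := G.contDiff_hatN.continuous
  have c3 := G.contDiff_hatD.continuous
  have c4 := G.contDiff_hatM.continuous
  filter_upwards [eventually_eq_of_off_axis (by fun_prop) (by fun_prop) hle, hN] with q h1 h2 hq
  rw [hq] at h1
  simp only [abs_zero, zero_mul] at h1
  have h3 : |formL F n q * hatN n h q| ≤ 0 := (le_max_left _ _).trans h1.le
  exact (mul_eq_zero.1 (abs_nonpos_iff.1 h3)).resolve_right h2

end Basic

section Curvatures

variable {l : Plane → ℝ}

theorem gaussCurv_mul_hatD (G : IsEdgeGerm F n h)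
    (hL : ∀ᶠ q in 𝓝 (0 : Plane), formL F n q = q.2 * l q) :
    ∀ᶠ q in 𝓝 (0 : Plane), q.2 ≠ 0 → gaussCurv F n q * hatD F h q = hatC n h l q := by
  filter_upwards [G.gaussCurv_eq, hL] with q h1 h2 hq
  apply mul_left_cancel₀ hq
  rw [hatC]
  rw [h2] at h1
  linear_combination h1 hq

theorem meanCurv_mul_hatD (G : IsEdgeGerm F n h)
    (hL : ∀ᶠ q in 𝓝 (0 : Plane), formL F n q = q.2 * l q) :
    ∀ᶠ q in 𝓝 (0 : Plane), q.2 ≠ 0 →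
      2 * meanCurv F n q * (q.2 * hatD F h q) = hatB F n h l q := by
  filter_upwards [G.hatD_pos, G.formM_eq, G.formN_eq, G.dv_eq, hL] with q h1 h2 h3 h4 h5 hq
  have hE : formE F q * formG F q - formF F q ^ 2 = q.2 ^ 2 * hatD F h q := by
    simp only [formE, formF, formG, h4, real_inner_smul_left, real_inner_smul_right, hatD]
    ring
  rw [meanCurv, hE, h2, h3, h5, hatB, formE, formF, formG, h4, real_inner_smul_left,
    real_inner_smul_right, real_inner_smul_right]
  field_simp

theorem hatB_zero_ne_zero (G : IsEdgeGerm F n h) : hatB F n h l 0 ≠ 0 := by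
  have := mul_ne_zero G.inner_du_self_pos.ne' G.hatN_ne_zero
  simpa [hatB] using this

end Curvatures

end IsEdgeGerm

/-- A principal curvature is a root of `κ² - 2Hκ + K`. -/
theorem eq_kappa_of_quadratic {f n : Plane → E3} {q : Plane} {k : ℝ}
    (hk : k ^ 2 - 2 * meanCurv f n q * k + gaussCurv f n q = 0) :
    k = kappa1 f n q ∨ k = kappa2 f n q := by
  have h1 : meanCurv f n q ^ 2 - gaussCurv f n q = (k - meanCurv f n q) ^ 2 := by
    linear_combination -hk
  rw [kappa1, kappa2, h1, Real.sqrt_sq_eq_abs]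
  rcases abs_cases (k - meanCurv f n q) with h | h
  · left
    rw [h.1]
    ring
  · right
    rw [h.1]
    ring

theorem quadratic_of_eq_kappa {f n : Plane → E3} {q : Plane} {k : ℝ}
    (hd : 0 ≤ meanCurv f n q ^ 2 - gaussCurv f n q)
    (hk : k = kappa1 f n q ∨ k = kappa2 f n q) :
    k ^ 2 - 2 * meanCurv f n q * k + gaussCurv f n q = 0 := by
  have hs := Real.sq_sqrt hd
  rcases hk with rfl | rfl
  · rw [kappa1]
    linear_combination hs
  · rw [kappa2]
    linear_combination hs

namespace IsEdgeGerm

variable {F n h : Plane → E3} {l : Plane → ℝ}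

/-- The discriminant `B̂² - 4v²D̂Ĉ` of the quadratic equation for the principal curvatures is
positive near the origin. -/
theorem discr_pos (G : IsEdgeGerm F n h) (hl : ContDiff ℝ ∞ l) :
    ∀ᶠ q in 𝓝 (0 : Plane),
      0 < hatB F n h l q ^ 2 - 4 * q.2 ^ 2 * hatD F h q * hatC n h l q := by
  have c1 := (G.contDiff_hatB hl).continuous
  have c2 := (G.contDiff_hatC hl).continuous
  have c3 := G.contDiff_hatD.continuous
  have hc : Continuous fun q : Plane =>
      hatB F n h l q ^ 2 - 4 * q.2 ^ 2 * hatD F h q * hatC n h l q := by fun_prop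
  refine hc.continuousAt.eventually (lt_mem_nhds ?_)
  have := sq_pos_of_ne_zero (G.hatB_zero_ne_zero (l := l))
  simpa using this

/-- The differential at the origin of any smooth function that is a principal curvature off the
axis is `(0, Ĉ/B̂)`. -/
theorem fderiv_principal (G : IsEdgeGerm F n h) (hl : ContDiff ℝ ∞ l)
    (hL : ∀ᶠ q in 𝓝 (0 : Plane), formL F n q = q.2 * l q) {κ : Plane → ℝ}
    (hκ : ∀ᶠ q in 𝓝 (0 : Plane), ContDiffAt ℝ ∞ κ q)
    (hp : ∀ᶠ q in 𝓝 (0 : Plane), q.2 ≠ 0 → κ q = kappa1 F n q ∨ κ q = kappa2 F n q) :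
    du κ 0 = 0 ∧ dv κ 0 = hatC n h l 0 / hatB F n h l 0 := by
  obtain ⟨k, hk, hkκ⟩ := exists_contDiff_eventuallyEq hκ
  have c0 := hk.continuous
  have c1 := (G.contDiff_hatB hl).continuous
  have c2 := (G.contDiff_hatC hl).continuous
  have c3 := G.contDiff_hatD.continuous
  have hq : ∀ᶠ q in 𝓝 (0 : Plane), q.2 ≠ 0 →
      q.2 * (hatD F h q * k q ^ 2 + hatC n h l q) = hatB F n h l q * k q := by
    filter_upwards [hkκ, hp, G.gaussCurv_mul_hatD hL, G.meanCurv_mul_hatD hL, G.hatD_pos,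
      G.discr_pos hl] with q e1 e2 e3 e4 e5 e6 hq
    have e3' := e3 hq
    have e4' := e4 hq
    have hd : 0 ≤ meanCurv F n q ^ 2 - gaussCurv F n q := by
      have hpos : 0 < 4 * q.2 ^ 2 * hatD F h q ^ 2 := by positivity
      rw [← mul_nonneg_iff_of_pos_right hpos]
      rw [← e4', ← e3'] at e6
      linarith
    have e7 := quadratic_of_eq_kappa hd (e2 hq)
    rw [← e1] at e7
    rw [← e3', ← e4']
    linear_combination q.2 * hatD F h q * e7
  have hB : ∀ᶠ q in 𝓝 (0 : Plane), hatB F n h l q ≠ 0 :=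
    c1.continuousAt.eventually_ne G.hatB_zero_ne_zero
  have heq : ∀ᶠ q in 𝓝 (0 : Plane), κ q =
      q.2 • ((hatD F h q * k q ^ 2 + hatC n h l q) / hatB F n h l q) := by
    filter_upwards [eventually_eq_of_off_axis (by fun_prop) (by fun_prop) hq, hB, hkκ]
      with q e1 e2 e3
    rw [← e3, smul_eq_mul, ← mul_div_assoc, e1]
    field_simp
  have hcont : ContinuousAt
      (fun q => (hatD F h q * k q ^ 2 + hatC n h l q) / hatB F n h l q) 0 :=
    ContinuousAt.div (by fun_prop) (by fun_prop) G.hatB_zero_ne_zero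
  have hk0 : k 0 = 0 := by
    rw [hkκ.self_of_nhds, heq.self_of_nhds]
    simp
  refine ⟨du_snd_smul rfl hcont heq, ?_⟩
  rw [dv_snd_smul rfl hcont heq, hk0]
  simp

/-- The bounded principal curvature exists. It is the root `2vĈ / (B̂ ± √(B̂² - 4v²D̂Ĉ))` of the
quadratic equation, with the sign of `B̂` in front of the square root. -/
theorem exists_principal (G : IsEdgeGerm F n h) (hl : ContDiff ℝ ∞ l)
    (hL : ∀ᶠ q in 𝓝 (0 : Plane), formL F n q = q.2 * l q) :
    ∃ κ : Plane → ℝ, (∀ᶠ q in 𝓝 (0 : Plane), ContDiffAt ℝ ∞ κ q) ∧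
      ∀ᶠ q in 𝓝 (0 : Plane), q.2 ≠ 0 → κ q = kappa1 F n q ∨ κ q = kappa2 F n q := by
  let b := hatB F n h l 0
  have hb : b ≠ 0 := G.hatB_zero_ne_zero
  let Δ : Plane → ℝ := fun q => hatB F n h l q ^ 2 - 4 * q.2 ^ 2 * hatD F h q * hatC n h l q
  -- `b/|b|` is the sign of `B̂`; multiplying through by `|b|` avoids it.
  let den : Plane → ℝ := fun q => |b| * hatB F n h l q + b * √(Δ q)
  have sB := G.contDiff_hatB hl
  have sC := G.contDiff_hatC hl
  have sD := G.contDiff_hatD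
  have ssnd : ContDiff ℝ ∞ (fun q : Plane => q.2) := contDiff_snd
  have sΔ : ContDiff ℝ ∞ Δ := (sB.pow 2).sub (((contDiff_const.mul (ssnd.pow 2)).mul sD).mul sC)
  have hΔ : ∀ᶠ q in 𝓝 (0 : Plane), 0 < Δ q := G.discr_pos hl
  have sden : ∀ᶠ q in 𝓝 (0 : Plane), ContDiffAt ℝ ∞ den q := by
    filter_upwards [hΔ] with q hq
    exact (contDiffAt_const.mul sB.contDiffAt).add
      (contDiffAt_const.mul (sΔ.contDiffAt.sqrt hq.ne'))
  have hden0 : den 0 ≠ 0 := by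
    have e : Δ 0 = b ^ 2 := by simp [Δ, b]
    have : den 0 = 2 * (|b| * b) := by
      change |b| * b + b * √(Δ 0) = _
      rw [e, Real.sqrt_sq_eq_abs]
      ring
    rw [this]
    exact mul_ne_zero two_ne_zero (mul_ne_zero (abs_ne_zero.2 hb) hb)
  have hden : ∀ᶠ q in 𝓝 (0 : Plane), den q ≠ 0 :=
    sden.self_of_nhds.continuousAt.eventually_ne hden0
  refine ⟨fun q => 2 * |b| * q.2 * hatC n h l q / den q, ?_, ?_⟩
  · filter_upwards [sden, hden] with q h1 h2
    exact ((contDiffAt_const.mul ssnd.contDiffAt).mul sC.contDiffAt).div h1 h2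
  · filter_upwards [hΔ, hden, G.hatD_pos, G.gaussCurv_mul_hatD hL, G.meanCurv_mul_hatD hL]
      with q h1 h2 h3 h4 h5 hq
    apply eq_kappa_of_quadratic
    have e4 := h4 hq
    have e5 := h5 hq
    have hs := Real.sq_sqrt h1.le
    have hab := sq_abs b
    apply (mul_eq_zero.1 (_ : (q.2 * hatD F h q) * _ = 0)).resolve_left
      (mul_ne_zero hq h3.ne')
    have key : q.2 * hatD F h q * (2 * |b| * q.2 * hatC n h l q / den q) ^ 2 -
        hatB F n h l q * (2 * |b| * q.2 * hatC n h l q / den q) + q.2 * hatC n h l q = 0 := by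
      have hs' : √(Δ q) ^ 2 =
          hatB F n h l q ^ 2 - 4 * q.2 ^ 2 * hatD F h q * hatC n h l q := hs
      field_simp
      simp only [den]
      linear_combination (q.2 * hatC n h l q) * ((4 * q.2 ^ 2 * hatD F h q * hatC n h l q
        - hatB F n h l q ^ 2) * hab + b ^ 2 * hs')
    rw [← e4, ← e5] at key
    rw [← e4]
    linear_combination key

end IsEdgeGerm

/-! ### The invariants of the cuspidal edge and the differential of the Gauss map -/

theorem continuous_det3 {a b c : Plane → E3} (ha : Continuous a) (hb : Continuous b)
    (hc : Continuous c) : Continuous fun q => det3 (a q) (b q) (c q) := by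
  simp only [det3_eq]
  fun_prop

namespace IsEdgeGerm

variable {F n h : Plane → E3} {l : Plane → ℝ}

theorem dv_dv_zero (G : IsEdgeGerm F n h) : dv (dv F) 0 = h 0 :=
  dv_snd_smul rfl G.smooth_factor.continuous.continuousAt G.dv_eq

theorem du_dv_zero (G : IsEdgeGerm F n h) : du (dv F) 0 = 0 :=
  du_snd_smul rfl G.smooth_factor.continuous.continuousAt G.dv_eq

theorem dv_dv_du_zero (G : IsEdgeGerm F n h) : dv (dv (du F)) 0 = du h 0 := by
  refine dv_snd_smul rfl (contDiff_du G.smooth_factor).continuous.continuousAt ?_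
  filter_upwards [G.dv_eq.eventually_nhds] with q hq
  have hq' : dv F =ᶠ[𝓝 q] fun y => y.2 • h y := hq
  have hd := (hasFDerivAt_snd (𝕜 := ℝ) (p := q)).smul
    (G.smooth_factor.differentiable (by simp) q).hasFDerivAt
  have e : fderiv ℝ (fun y : Plane => y.2 • h y) q = _ := hd.fderiv
  rw [dv_du_comm G.smooth.contDiffAt, (du_congr hq').eq_of_nhds]
  simp [du, e]

theorem inner_du_du_normal (G : IsEdgeGerm F n h) (h0 : formL F n 0 = 0) :
    inner ℝ (du (du F) 0) (n 0) = 0 := by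
  have h1 := du_eq_zero_of_eventually_const G.ortho_du
  rw [du_inner ((contDiff_du G.smooth).differentiable (by simp) 0)
    (G.smooth_normal.differentiable (by simp) 0)] at h1
  rw [formL] at h0
  linarith

theorem inner_du_factor_normal (G : IsEdgeGerm F n h) :
    inner ℝ (du h 0) (n 0) = hatM n h 0 := by
  have h1 := du_eq_zero_of_eventually_const G.inner_factor_normal
  rw [du_inner (G.smooth_factor.differentiable (by simp) 0)
    (G.smooth_normal.differentiable (by simp) 0)] at h1
  rw [hatM]
  linarith

/-- `det(F_u, h, w)` is proportional to the normal component of `w`. -/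
theorem det3_mul_det3_normal (G : IsEdgeGerm F n h) (w : E3) :
    det3 (du F 0) (h 0) w * det3 (du F 0) (h 0) (n 0) = hatD F h 0 * inner ℝ w (n 0) := by
  rw [det3_mul_det3, G.ortho_du.self_of_nhds, G.inner_factor_normal.self_of_nhds, hatD,
    real_inner_comm (du F 0) (h 0)]
  ring

/-- The cuspidal torsion is a non-zero multiple of `M / v`. -/
theorem cuspidalTorsion_eq_zero_iff (G : IsEdgeGerm F n h) (h0 : formL F n 0 = 0) :
    cuspidalTorsion F 0 = 0 ↔ hatM n h 0 = 0 := by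
  have hδ := G.det3_ne_zero.self_of_nhds
  have hD := G.hatD_pos.self_of_nhds
  have h1 : det3 (du F 0) (h 0) (du (du F) 0) = 0 := by
    have := G.det3_mul_det3_normal (du (du F) 0)
    rw [G.inner_du_du_normal h0, mul_zero] at this
    exact (mul_eq_zero.1 this).resolve_right hδ
  have h2 := G.det3_mul_det3_normal (du h 0)
  rw [G.inner_du_factor_normal] at h2
  have h3 : ‖cross (du F 0) (h 0)‖ ^ 2 ≠ 0 := by
    rw [norm_cross_sq]
    exact G.indep.ne'
  rw [cuspidalTorsion, G.dv_dv_zero, G.dv_dv_du_zero, h1, mul_zero, zero_div, sub_zero,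
    div_eq_zero_iff, or_iff_left h3]
  constructor
  · intro h4
    rw [h4, zero_mul] at h2
    exact (mul_eq_zero.1 h2.symm).resolve_left hD.ne'
  · intro h4
    rw [h4, mul_zero] at h2
    exact (mul_eq_zero.1 h2).resolve_right hδ

/-- The derivative of `L` across the singular curve is `⟨F_uu, n_v⟩`. -/
theorem inner_du_du_dv (G : IsEdgeGerm F n h) (hl : ContDiff ℝ ∞ l)
    (hL : ∀ᶠ q in 𝓝 (0 : Plane), formL F n q = q.2 * l q) :
    inner ℝ (du (du F) 0) (dv n 0) = l 0 := by
  have dF := (contDiff_du G.smooth).differentiable (by simp) 0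
  have du_n := (contDiff_du G.smooth_normal).differentiable (by simp) 0
  have dv_n := (contDiff_dv G.smooth_normal).differentiable (by simp) 0
  have h1 : dv (fun q => inner ℝ (du F q) (du n q)) 0 = -l 0 := by
    refine dv_snd_smul (k := fun q => -l q) rfl hl.continuous.neg.continuousAt ?_
    filter_upwards [hL] with q hq
    rw [formL] at hq
    rw [smul_eq_mul]
    linarith
  have h2 : du (fun q => inner ℝ (du F q) (dv n q)) 0 = 0 := by
    refine du_snd_smul (k := fun q => -hatM n h q) rfl
      G.contDiff_hatM.continuous.neg.continuousAt ?_
    filter_upwards [G.inner_du_dv] with q hq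
    rw [hq, smul_eq_mul]
    ring
  rw [dv_inner dF du_n, dv_du_comm G.smooth.contDiffAt, G.du_dv_zero, inner_zero_left, add_zero,
    dv_du_comm G.smooth_normal.contDiffAt] at h1
  rw [du_inner dF dv_n] at h2
  linarith

/-- The singular curvature is a non-zero multiple of `L / v`. -/
theorem singularCurv_ne_zero_iff (G : IsEdgeGerm F n h) (hl : ContDiff ℝ ∞ l)
    (hL : ∀ᶠ q in 𝓝 (0 : Plane), formL F n q = q.2 * l q) :
    singularCurv F n 0 ≠ 0 ↔ l 0 ≠ 0 := by
  have h0 : formL F n 0 = 0 := by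
    rw [hL.self_of_nhds]
    simp
  have hE := G.inner_du_self_pos.ne'
  have hn := G.unit.self_of_nhds
  have hun := G.ortho_du.self_of_nhds
  have huv : inner ℝ (du F 0) (dv n 0) = (0 : ℝ) := by
    rw [G.inner_du_dv.self_of_nhds]
    simp
  have hdet : dv (areaDensity F n) 0 = det3 (du F 0) (h 0) (n 0) := by
    refine dv_snd_smul (k := fun q => det3 (du F q) (h q) (n q)) rfl
      (continuous_det3 (contDiff_du G.smooth).continuous G.smooth_factor.continuous
        G.smooth_normal.continuous).continuousAt ?_
    filter_upwards [G.dv_eq] with q hq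
    rw [areaDensity, hq, det3_smul_right, smul_eq_mul]
  have hsign : Real.sign (dv (areaDensity F n) 0) ≠ 0 := by
    rw [Ne, Real.sign_eq_zero_iff, hdet]
    exact G.det3_ne_zero.self_of_nhds
  have hnorm : ‖du F 0‖ ^ 3 ≠ 0 := by
    refine pow_ne_zero _ fun hz => hE ?_
    rw [real_inner_self_eq_norm_sq, hz]
    simp
  have h1 : det3 (du F 0) (du (du F) 0) (n 0) * det3 (du F 0) (dv n 0) (n 0) =
      inner ℝ (du F 0) (du F 0) * l 0 := by
    rw [det3_mul_det3, hn, hun, huv, G.inner_du_du_normal h0, G.inner_du_du_dv hl hL]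
    ring
  have h2 : det3 (du F 0) (dv n 0) (n 0) ≠ 0 := by
    intro hz
    have h3 := det3_mul_det3 (du F 0) (dv n 0) (n 0) (du F 0) (dv n 0) (n 0)
    rw [hz, hn, hun, huv, real_inner_comm (n 0) (dv n 0), G.inner_normal_dv.self_of_nhds] at h3
    have h4 : inner ℝ (du F 0) (du F 0) * inner ℝ (dv n 0) (dv n 0) = (0 : ℝ) := by linarith
    exact G.immersion (inner_self_eq_zero.1 ((mul_eq_zero.1 h4).resolve_left hE))
  rw [singularCurv]
  simp only [ne_eq, mul_eq_zero, div_eq_zero_iff, hsign, hnorm, false_or, or_false]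
  refine not_congr ⟨fun hz => ?_, fun hz => ?_⟩
  · rw [hz, zero_mul] at h1
    exact (mul_eq_zero.1 h1.symm).resolve_left hE
  · rw [hz, mul_zero] at h1
    exact (mul_eq_zero.1 h1).resolve_right h2

/-- Along the singular curve the kernel of the differential of the Gauss map contains
`N̂ ∂_u - M̂ ∂_v`. -/
theorem kernel_normal (G : IsEdgeGerm F n h)
    (hL : ∀ᶠ q in 𝓝 (0 : Plane), formL F n q = q.2 * l q) :
    ∀ᶠ q in 𝓝 (0 : Plane), q.2 = 0 → fderiv ℝ n q (hatN n h q, -hatM n h q) = 0 := by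
  filter_upwards [G.det3_ne_zero, G.inner_du_dv, G.inner_normal_du, G.inner_normal_dv, hL]
    with q h1 h2 h3 h4 h5 hq
  rw [fderiv_apply_eq_du_dv]
  refine eq_zero_of_inner_eq_zero h1 ?_ ?_ ?_ <;>
    rw [inner_add_right, real_inner_smul_right, real_inner_smul_right]
  · have h6 : inner ℝ (du F q) (du n q) = (0 : ℝ) := by
      rw [hq, formL] at h5
      linarith
    rw [h2, h6, hq]
    ring
  · rw [hatN, hatM]
    ring
  · rw [h3, h4]
    ring

theorem det3_normal (G : IsEdgeGerm F n h)
    (hL : ∀ᶠ q in 𝓝 (0 : Plane), formL F n q = q.2 * l q) :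
    ∀ᶠ q in 𝓝 (0 : Plane), det3 (du n q) (dv n q) (n q) * det3 (du F q) (h q) (n q) =
      q.2 * hatC n h l q := by
  filter_upwards [G.unit, G.inner_du_dv, G.inner_normal_du, G.inner_normal_dv, hL,
    G.inner_factor_normal, G.ortho_du] with q h1 h2 h3 h4 h5 h6 h7
  have e1 : inner ℝ (du n q) (du F q) = -(q.2 * l q) := by
    rw [← h5, formL, neg_neg, real_inner_comm]
  have e2 : inner ℝ (dv n q) (du F q) = -(q.2 * hatM n h q) := by rw [← h2, real_inner_comm]
  have e3 : inner ℝ (du n q) (h q) = -hatM n h q := by rw [hatM, neg_neg, real_inner_comm]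
  have e4 : inner ℝ (dv n q) (h q) = -hatN n h q := by rw [hatN, neg_neg, real_inner_comm]
  have e5 : inner ℝ (du n q) (n q) = (0 : ℝ) := by rw [← h3, real_inner_comm]
  have e6 : inner ℝ (dv n q) (n q) = (0 : ℝ) := by rw [← h4, real_inner_comm]
  rw [det3_mul_det3, h1, e1, e2, e3, e4, e5, e6, hatC]
  ring

end IsEdgeGerm

/-! ### Changes of coordinates -/

theorem du_comp {F : Type} [NormedAddCommGroup F] [NormedSpace ℝ F] {g : Plane → F}
    {ψ : Plane → Plane} {y : Plane} (hg : DifferentiableAt ℝ g (ψ y))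
    (hψ : DifferentiableAt ℝ ψ y) :
    du (g ∘ ψ) y = (du ψ y).1 • du g (ψ y) + (du ψ y).2 • dv g (ψ y) := by
  rw [du, fderiv_comp y hg hψ, ContinuousLinearMap.comp_apply, fderiv_apply_eq_du_dv]
  rfl

theorem dv_comp {F : Type} [NormedAddCommGroup F] [NormedSpace ℝ F] {g : Plane → F}
    {ψ : Plane → Plane} {y : Plane} (hg : DifferentiableAt ℝ g (ψ y))
    (hψ : DifferentiableAt ℝ ψ y) :
    dv (g ∘ ψ) y = (dv ψ y).1 • du g (ψ y) + (dv ψ y).2 • dv g (ψ y) := by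
  rw [dv, fderiv_comp y hg hψ, ContinuousLinearMap.comp_apply, fderiv_apply_eq_du_dv]
  rfl

/-- The Gaussian and mean curvatures do not depend on the coordinates. -/
theorem curvatures_comp {f n : Plane → E3} {ψ : Plane → Plane} {y : Plane}
    (hf : DifferentiableAt ℝ f (ψ y)) (hn : DifferentiableAt ℝ n (ψ y))
    (hψ : DifferentiableAt ℝ ψ y)
    (hdet : (du ψ y).1 * (dv ψ y).2 - (du ψ y).2 * (dv ψ y).1 ≠ 0)
    (hsymm : inner ℝ (du f (ψ y)) (dv n (ψ y)) = inner ℝ (dv f (ψ y)) (du n (ψ y))) :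
    gaussCurv (f ∘ ψ) (n ∘ ψ) y = gaussCurv f n (ψ y) ∧
    meanCurv (f ∘ ψ) (n ∘ ψ) y = meanCurv f n (ψ y) := by
  have h2 := pow_ne_zero 2 hdet
  have c := real_inner_comm (du f (ψ y)) (dv f (ψ y))
  constructor
  · rw [gaussCurv, gaussCurv]
    refine Eq.trans ?_ (mul_div_mul_left _ _ h2)
    simp only [formE, formF, formG, formL, formM, formN, du_comp hf hψ, dv_comp hf hψ,
      du_comp hn hψ, dv_comp hn hψ, inner_add_left, inner_add_right, real_inner_smul_left,
      real_inner_smul_right, hsymm, c]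
    congr 1 <;> ring
  · rw [meanCurv, meanCurv]
    refine Eq.trans ?_ (mul_div_mul_left _ _ h2)
    simp only [formE, formF, formG, formL, formM, formN, du_comp hf hψ, dv_comp hf hψ,
      du_comp hn hψ, dv_comp hn hψ, inner_add_left, inner_add_right, real_inner_smul_left,
      real_inner_smul_right, hsymm, c]
    congr 1 <;> ring

theorem curvatures_congr {f f' n n' : Plane → E3} {q : Plane} (hf : f =ᶠ[𝓝 q] f')
    (hn : n =ᶠ[𝓝 q] n') :
    gaussCurv f n q = gaussCurv f' n' q ∧ meanCurv f n q = meanCurv f' n' q := by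
  simp only [gaussCurv, meanCurv, formE, formF, formG, formL, formM, formN,
    (du_congr hf).eq_of_nhds, (dv_congr hf).eq_of_nhds, (du_congr hn).eq_of_nhds,
    (dv_congr hn).eq_of_nhds, and_self]

section PartialDiffeo

variable (x : PartialDiffeomorph 𝓘(ℝ, Plane) 𝓘(ℝ, Plane) Plane Plane ∞)

theorem contDiffAt_partialDiffeo {q : Plane} (hq : q ∈ x.source) : ContDiffAt ℝ ∞ x q :=
  x.contMDiffOn_toFun.contDiffOn.contDiffAt (x.open_source.mem_nhds hq)

theorem contDiffAt_partialDiffeo_symm {y : Plane} (hy : y ∈ x.target) :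
    ContDiffAt ℝ ∞ x.symm y :=
  contDiffAt_partialDiffeo x.symm hy

theorem fderiv_partialDiffeo_eq_zero {q w : Plane} (hq : q ∈ x.source)
    (h : fderiv ℝ x q w = 0) : w = 0 := by
  obtain ⟨A, B, hA, -, hBA, -⟩ := partialDiffeo_deriv x hq
  rw [hA.fderiv] at h
  have := congrArg (fun T : Plane →L[ℝ] Plane => T w) hBA
  simpa [h] using this.symm

theorem partialDiffeo_det_ne_zero {q : Plane} (hq : q ∈ x.source) :
    (du x q).1 * (dv x q).2 - (du x q).2 * (dv x q).1 ≠ 0 := by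
  intro h0
  -- The kernel contains the columns of the adjugate matrix.
  have h1 : ((dv x q).2, -(du x q).2) = (0 : Plane) := by
    apply fderiv_partialDiffeo_eq_zero x hq
    rw [fderiv_apply_eq_du_dv]
    ext
    · simp
      linarith
    · simp
      ring
  have h2 : ((dv x q).1, -(du x q).1) = (0 : Plane) := by
    apply fderiv_partialDiffeo_eq_zero x hq
    rw [fderiv_apply_eq_du_dv]
    ext
    · simp
      ring
    · simp
      linarith
  have h3 : dv x q = 0 := Prod.ext (Prod.mk.inj h2).1 (Prod.mk.inj h1).1
  have h4 : ((0, 1) : Plane) = 0 := fderiv_partialDiffeo_eq_zero x hq h3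
  simpa using congrArg Prod.snd h4

end PartialDiffeo

/-! ### The factor of `f_v` at a cuspidal edge -/

/-- At a cuspidal edge, `F_u` and `h = F_v / v` are linearly independent. -/
theorem indep_of_cuspidalEdge {F h : Plane → E3} (hF : ContDiff ℝ ∞ F) (hh : ContDiff ℝ ∞ h)
    (hdv : ∀ᶠ q in 𝓝 (0 : Plane), dv F q = q.2 • h q)
    (R : PartialDiffeomorph 𝓘(ℝ, Plane) 𝓘(ℝ, Plane) Plane Plane ∞)
    (Φ : PartialDiffeomorph 𝓘(ℝ, E3) 𝓘(ℝ, E3) E3 E3 ∞)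
    (hR : 0 ∈ R.source) (hR0 : R 0 = 0) (hΦ : F 0 ∈ Φ.source)
    (hmodel : ∀ᶠ q in 𝓝 (0 : Plane), Φ (F q) = !₂[(R q).1, (R q).2 ^ 2, (R q).2 ^ 3]) :
    0 < inner ℝ (du F 0) (du F 0) * inner ℝ (h 0) (h 0) - inner ℝ (du F 0) (h 0) ^ 2 := by
  have sR : ∀ᶠ q in 𝓝 (0 : Plane), ContDiffAt ℝ ∞ R q := by
    filter_upwards [R.open_source.mem_nhds hR] with q hq using contDiffAt_partialDiffeo R hq
  have sΦ : ∀ᶠ q in 𝓝 (0 : Plane), ContDiffAt ℝ ∞ Φ (F q) := by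
    filter_upwards [hF.continuous.continuousAt.preimage_mem_nhds (Φ.open_source.mem_nhds hΦ)]
      with q hq
    exact Φ.contMDiffOn_toFun.contDiffOn.contDiffAt (Φ.open_source.mem_nhds hq)
  let A : Plane → E3 →L[ℝ] E3 := fun q => fderiv ℝ Φ (F q)
  have hA : ContinuousAt A 0 :=
    (sΦ.self_of_nhds.continuousAt_fderiv (by simp)).comp hF.continuous.continuousAt
  have hchain : ∀ᶠ q in 𝓝 (0 : Plane), ∀ i : Fin 3,
      du (fun y => Φ (F y) i) q = A q (du F q) i ∧ dv (fun y => Φ (F y) i) q = A q (dv F q) i := by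
    filter_upwards [sΦ] with q hq i
    have h1 := (hq.differentiableAt (by simp)).hasFDerivAt.comp q
      (hF.differentiable (by simp) q).hasFDerivAt
    have h2 := ((EuclideanSpace.proj i : E3 →L[ℝ] ℝ).hasFDerivAt).comp q h1
    have e : fderiv ℝ (fun y => Φ (F y) i) q = _ := h2.fderiv
    constructor
    · rw [du, e]
      rfl
    · rw [dv, e]
      rfl
  let b : Plane → ℝ := fun q => (R q).2
  have sb : ∀ᶠ q in 𝓝 (0 : Plane), ContDiffAt ℝ ∞ b q := by
    filter_upwards [sR] with q hq using contDiffAt_snd.comp q hq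
  have hb0 : b 0 = 0 := by simp only [b, hR0]; rfl
  have e0 : (fun q => Φ (F q) 0) =ᶠ[𝓝 0] fun q => (R q).1 := by
    filter_upwards [hmodel] with q hq
    rw [hq]
    rfl
  have e1 : (fun q => Φ (F q) 1) =ᶠ[𝓝 0] fun q => b q ^ 2 := by
    filter_upwards [hmodel] with q hq
    rw [hq]
    rfl
  have hfst : du (fun q => (R q).1) 0 = (du R 0).1 ∧ dv (fun q => (R q).1) 0 = (dv R 0).1 := by
    have h1 := (sR.self_of_nhds.differentiableAt (by simp)).hasFDerivAt.fst
    exact ⟨by rw [du, h1.fderiv]; rfl, by rw [dv, h1.fderiv]; rfl⟩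
  have hsnd : du b 0 = (du R 0).2 ∧ dv b 0 = (dv R 0).2 := by
    have h1 := (sR.self_of_nhds.differentiableAt (by simp)).hasFDerivAt.snd
    have e : fderiv ℝ b 0 = _ := h1.fderiv
    exact ⟨by rw [du, e]; rfl, by rw [dv, e]; rfl⟩
  have hsq : ∀ᶠ q in 𝓝 (0 : Plane), du (fun q => b q ^ 2) q = 2 * b q * du b q ∧
      dv (fun q => b q ^ 2) q = 2 * b q * dv b q := by
    filter_upwards [sb] with q hq
    have h1 := (hq.differentiableAt (by simp)).hasFDerivAt.pow 2
    have e : fderiv ℝ (fun q => b q ^ 2) q = _ := h1.fderiv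
    constructor
    · rw [du, e]
      simp [du]
    · rw [dv, e]
      simp [dv]
  have hF0 : dv F 0 = 0 := by
    rw [hdv.self_of_nhds]
    simp
  -- The first component of `Φ ∘ F`.
  have f0 : A 0 (du F 0) 0 = (du R 0).1 := by
    rw [← (hchain.self_of_nhds 0).1, (du_congr e0).eq_of_nhds, hfst.1]
  have f1 : (dv R 0).1 = 0 := by
    rw [← hfst.2, ← (dv_congr e0).eq_of_nhds, (hchain.self_of_nhds 0).2, hF0, map_zero]
    rfl
  -- The second component of `Φ ∘ F` is a square, and its second derivative is `2 b_v²`.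
  have f2 : A 0 (du F 0) 1 = 0 := by
    rw [← (hchain.self_of_nhds 1).1, (du_congr e1).eq_of_nhds, hsq.self_of_nhds.1, hb0]
    ring
  have f3 : A 0 (h 0) 1 = 2 * (dv R 0).2 ^ 2 := by
    have g1 : dv (dv (fun y => Φ (F y) 1)) 0 = A 0 (h 0) 1 := by
      refine dv_snd_smul (k := fun q => A q (h q) 1) rfl ?_ ?_
      · exact ((EuclideanSpace.proj (1 : Fin 3) : E3 →L[ℝ] ℝ).continuous.continuousAt).comp
          (hA.clm_apply hh.continuous.continuousAt)
      · filter_upwards [hchain, hdv] with q h1 h2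
        rw [(h1 1).2, h2, map_smul]
        rfl
    have g2 : dv (fun y => Φ (F y) 1) =ᶠ[𝓝 0] fun q => 2 * b q * dv b q := by
      refine (dv_congr e1).trans ?_
      filter_upwards [hsq] with q hq using hq.2
    have d1 := (sb.self_of_nhds.differentiableAt (by simp)).hasFDerivAt.const_mul 2
    have d2 := ((contDiffAt_dv sb.self_of_nhds).differentiableAt (by simp)).hasFDerivAt
    have e : fderiv ℝ (fun q => 2 * b q * dv b q) 0 = _ := (d1.mul d2).fderiv
    rw [← g1, (dv_congr g2).eq_of_nhds, dv, e, ← hsnd.2]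
    simp [hb0, dv]
    ring
  have hdet := partialDiffeo_det_ne_zero R hR
  rw [f1, mul_zero, sub_zero] at hdet
  apply gram_pos
  intro s t hst
  have hA0 : s • A 0 (du F 0) + t • A 0 (h 0) = 0 := by
    rw [← map_smul, ← map_smul, ← map_add, hst, map_zero]
  have c1 := congrArg (fun z : E3 => z 1) hA0
  have c0 := congrArg (fun z : E3 => z 0) hA0
  simp only [PiLp.add_apply, PiLp.smul_apply, smul_eq_mul, PiLp.zero_apply, f0, f2, f3,
    mul_zero, zero_add] at c0 c1
  have ht : t = 0 := by
    refine (mul_eq_zero.1 c1).resolve_right ?_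
    exact mul_ne_zero two_ne_zero (pow_ne_zero 2 (right_ne_zero_of_mul hdet))
  rw [ht, zero_mul, add_zero] at c0
  exact ⟨(mul_eq_zero.1 c0).resolve_right (left_ne_zero_of_mul hdet), ht⟩

/-! ### The Gauss map as a map into the sphere -/

theorem contMDiff_coe_S2 : ContMDiff (𝓡 2) 𝓘(ℝ, E3) ∞ ((↑) : S2 → E3) :=
  have : Fact (Module.finrank ℝ E3 = 2 + 1) := ⟨finrank_euclideanSpace_fin⟩
  contMDiff_coe_sphere

theorem injective_mfderiv_coe_S2 (z : S2) :
    Function.Injective (mfderiv (𝓡 2) 𝓘(ℝ, E3) ((↑) : S2 → E3) z) := by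
  have : Fact (Module.finrank ℝ E3 = 2 + 1) := ⟨finrank_euclideanSpace_fin⟩
  exact injective_mvfderiv_subtypeVal_sphere (E := E3) (n := 2) z

theorem contDiffAt_ambient {ν : Plane → S2} {q : Plane}
    (hν : ContMDiffAt 𝓘(ℝ, Plane) (𝓡 2) ∞ ν q) : ContDiffAt ℝ ∞ (ambient ν) q :=
  (contMDiff_coe_S2.contMDiffAt.comp q hν).contDiffAt

/-- A coordinate system of the sphere turns the Gauss map into a map of the plane whose differential
has the same kernel as that of the ambient Gauss map. -/
theorem fderiv_chart_eq_zero_iff {ν : Plane → S2} {q : Plane}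
    (hν : ContMDiffAt 𝓘(ℝ, Plane) (𝓡 2) ∞ ν q)
    (Ψ : PartialDiffeomorph (𝓡 2) 𝓘(ℝ, Plane) S2 Plane ∞) (hΨ : ν q ∈ Ψ.source) (w : Plane) :
    fderiv ℝ (Ψ ∘ ν) q w = 0 ↔ fderiv ℝ (ambient ν) q w = 0 := by
  have d1 : MDifferentiableAt 𝓘(ℝ, Plane) (𝓡 2) ν q := hν.mdifferentiableAt (by simp)
  have d2 : MDifferentiableAt (𝓡 2) 𝓘(ℝ, Plane) Ψ (ν q) := Ψ.mdifferentiableAt (by simp) hΨ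
  have d3 : MDifferentiableAt (𝓡 2) 𝓘(ℝ, E3) ((↑) : S2 → E3) (ν q) :=
    contMDiff_coe_S2.mdifferentiableAt (by simp)
  have hloc : IsLocalDiffeomorphAt (𝓡 2) 𝓘(ℝ, Plane) ∞ Ψ (ν q) :=
    Ψ.isLocalDiffeomorphAt (𝓡 2) 𝓘(ℝ, Plane) ∞ hΨ
  have i2 : Function.Injective (mfderiv (𝓡 2) 𝓘(ℝ, Plane) Ψ (ν q)) :=
    (hloc.mfderivToContinuousLinearEquiv (by simp)).injective
  have i3 := injective_mfderiv_coe_S2 (ν q)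
  have e2 : fderiv ℝ (Ψ ∘ ν) q w =
      mfderiv (𝓡 2) 𝓘(ℝ, Plane) Ψ (ν q) (mfderiv 𝓘(ℝ, Plane) (𝓡 2) ν q w) := by
    rw [← mfderiv_eq_fderiv, mfderiv_comp q d2 d1]
    rfl
  have e3 : fderiv ℝ (ambient ν) q w =
      mfderiv (𝓡 2) 𝓘(ℝ, E3) ((↑) : S2 → E3) (ν q) (mfderiv 𝓘(ℝ, Plane) (𝓡 2) ν q w) := by
    rw [← mfderiv_eq_fderiv]
    change mfderiv 𝓘(ℝ, Plane) 𝓘(ℝ, E3) (((↑) : S2 → E3) ∘ ν) q w = _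
    rw [mfderiv_comp q d3 d1]
    rfl
  rw [e2, e3]
  exact (map_eq_zero_iff _ i2).trans (map_eq_zero_iff _ i3).symm

/-- Smooth coordinates of the sphere around a given point, which they send to the origin. -/
theorem exists_sphere_coordinates (z : S2) :
    ∃ Ψ : PartialDiffeomorph (𝓡 2) 𝓘(ℝ, Plane) S2 Plane ∞, z ∈ Ψ.source ∧ Ψ z = 0 := by
  let c := chartAt (EuclideanSpace ℝ (Fin 2)) z
  let P : PartialDiffeomorph (𝓡 2) (𝓡 2) S2 (EuclideanSpace ℝ (Fin 2)) ∞ :=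
    ⟨c.toPartialEquiv, c.open_source, c.open_target, contMDiffOn_chart, contMDiffOn_chart_symm⟩
  let A : EuclideanSpace ℝ (Fin 2) ≃L[ℝ] Plane :=
    (PiLp.continuousLinearEquiv 2 ℝ (fun _ : Fin 2 => ℝ)).trans
      (ContinuousLinearEquiv.finTwoArrow ℝ ℝ)
  have s : ContDiff ℝ ∞ (fun y : Plane => y - A (c z)) := by fun_prop
  obtain ⟨T, hT, hT'⟩ := exists_partialDiffeomorph (g := fun y : Plane => y - A (c z))
    (a := A (c z)) (Eventually.of_forall fun q => s.contDiffAt)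
    (A := ContinuousLinearEquiv.refl ℝ Plane) ((hasFDerivAt_id _).sub_const _)
  refine ⟨(P.trans A.toDiffeomorph.toPartialDiffeomorph).trans T, ?_, ?_⟩
  · exact ⟨⟨mem_chart_source _ z, trivial⟩, hT⟩
  · exact (hT' _).trans (sub_self _)

/-! ### A cuspidal edge in adapted coordinates -/

section Adapted

variable {D : Set Plane} {f : Plane → E3} {ν : Plane → S2} {p : Plane}
  {x : PartialDiffeomorph 𝓘(ℝ, Plane) 𝓘(ℝ, Plane) Plane Plane ∞}

namespace IsAdapted

theorem zero_mem_target (hx : IsAdapted D f p x) : (0 : Plane) ∈ x.target := by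
  have h := x.map_source hx.mem
  rwa [show x.toPartialEquiv p = (0 : Plane) from hx.centered] at h

theorem symm_zero (hx : IsAdapted D f p x) : x.symm 0 = p := by
  have h : x.symm (x p) = p := x.left_inv hx.mem
  rwa [hx.centered] at h

theorem eventually_target (hx : IsAdapted D f p x) : ∀ᶠ y in 𝓝 (0 : Plane), y ∈ x.target :=
  x.open_target.mem_nhds hx.zero_mem_target

theorem tendsto_symm (hx : IsAdapted D f p x) : Tendsto x.symm (𝓝 0) (𝓝 p) := by
  have h := (contDiffAt_partialDiffeo_symm x hx.zero_mem_target).continuousAt.tendsto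
  rwa [hx.symm_zero] at h

theorem tendsto (hx : IsAdapted D f p x) : Tendsto x (𝓝 p) (𝓝 0) := by
  have h := (contDiffAt_partialDiffeo x hx.mem).continuousAt.tendsto
  rwa [hx.centered] at h

theorem symm_mem_source {y : Plane} (hy : y ∈ x.target) : x.symm y ∈ x.source := x.map_target hy

theorem apply_symm {y : Plane} (hy : y ∈ x.target) : x (x.symm y) = y := x.right_inv hy

theorem symm_mem (hx : IsAdapted D f p x) {y : Plane} (hy : y ∈ x.target) : x.symm y ∈ D :=
  hx.subset (symm_mem_source hy)

theorem symm_notMem_singularSet (hx : IsAdapted D f p x) {y : Plane} (hy : y ∈ x.target)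
    (h : y.2 ≠ 0) : x.symm y ∉ singularSet D f := by
  rw [hx.singular_iff _ (symm_mem_source hy), apply_symm hy]
  exact h

end IsAdapted

theorem IsFront.contDiffAt (hf : IsFront D f ν) (hD : IsOpen D) {q : Plane} (hq : q ∈ D) :
    ContDiffAt ℝ ∞ f q :=
  hf.smooth.contDiffAt (hD.mem_nhds hq)

theorem IsFront.contMDiffAt_gauss (hf : IsFront D f ν) (hD : IsOpen D) {q : Plane} (hq : q ∈ D) :
    ContMDiffAt 𝓘(ℝ, Plane) (𝓡 2) ∞ ν q :=
  hf.smooth_gauss.contMDiffAt (hD.mem_nhds hq)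

theorem IsFront.inner_dv_du (hf : IsFront D f ν) (hD : IsOpen D) {q : Plane} (hq : q ∈ D) :
    inner ℝ (du f q) (dv (ambient ν) q) = inner ℝ (dv f q) (du (ambient ν) q) := by
  refine inner_du_dv_symm (hf.contDiffAt hD hq) (contDiffAt_ambient (hf.contMDiffAt_gauss hD hq))
    ?_ ?_
  all_goals
    filter_upwards [hD.mem_nhds hq] with y hy
    exact hf.orthogonal y hy _

/-- The data attached to a cuspidal edge with bounded Gaussian curvature: in adapted coordinates the
front and its normal are the germs of globally smooth maps `F` and `n`, and `F_v = v h`, `L = v l`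
with smooth `h` and `l`. -/
structure IsEdgeData (f : Plane → E3) (ν : Plane → S2)
    (x : PartialDiffeomorph 𝓘(ℝ, Plane) 𝓘(ℝ, Plane) Plane Plane ∞)
    (F n h : Plane → E3) (l : Plane → ℝ) : Prop where
  germ : IsEdgeGerm F n h
  smooth_l : ContDiff ℝ ∞ l
  formL_eq : ∀ᶠ q in 𝓝 (0 : Plane), formL F n q = q.2 * l q
  front_eq : F =ᶠ[𝓝 0] f ∘ x.symm
  normal_eq : n =ᶠ[𝓝 0] ambient ν ∘ x.symm
  gauss_eq : ∀ᶠ q in 𝓝 (0 : Plane), gaussCurv F n q = gaussCurv f (ambient ν) (x.symm q)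
  mean_eq : ∀ᶠ q in 𝓝 (0 : Plane), meanCurv F n q = meanCurv f (ambient ν) (x.symm q)

/-- This is where the cuspidal edge and the bound on the Gaussian curvature enter: the former makes
`F_u` and `h` independent, the latter makes `L` divisible by `v`. -/
theorem exists_isEdgeData (hD : IsOpen D) (hf : IsFront D f ν) (hp : IsCuspidalEdge D f p)
    {C : ℝ} (hC : ∀ᶠ q in 𝓝 p, q ∉ singularSet D f → |gaussCurv f (ambient ν) q| ≤ C)
    (hx : IsAdapted D f p x) : ∃ F n h l, IsEdgeData f ν x F n h l := by
  have hψ : ∀ y ∈ x.target, ContDiffAt ℝ ∞ x.symm y := fun y => contDiffAt_partialDiffeo_symm x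
  have hψd : ∀ y ∈ x.target, DifferentiableAt ℝ x.symm y :=
    fun y hy => (hψ y hy).differentiableAt (by simp)
  have sf : ∀ y ∈ x.target, ContDiffAt ℝ ∞ f (x.symm y) :=
    fun y hy => hf.contDiffAt hD (hx.symm_mem hy)
  have sν : ∀ y ∈ x.target, ContDiffAt ℝ ∞ (ambient ν) (x.symm y) :=
    fun y hy => contDiffAt_ambient (hf.contMDiffAt_gauss hD (hx.symm_mem hy))
  have hT := hx.eventually_target
  obtain ⟨F, sF, hF⟩ := exists_contDiff_eventuallyEq (g := f ∘ x.symm) (a := 0) (by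
    filter_upwards [hT] with y hy using (sf y hy).comp y (hψ y hy))
  obtain ⟨n, sn, hn⟩ := exists_contDiff_eventuallyEq (g := ambient ν ∘ x.symm) (a := 0) (by
    filter_upwards [hT] with y hy using (sν y hy).comp y (hψ y hy))
  have hnull : ∀ᶠ y in 𝓝 (0 : Plane), y.2 = 0 → dv F y = 0 := by
    filter_upwards [hT, dv_congr hF] with y hy h1 h2
    rw [h1]
    have e : y = (y.1, (0 : ℝ)) := Prod.ext rfl h2
    have h3 := hx.null y.1
    rw [← e] at h3
    exact h3 hy
  obtain ⟨h, sh, hh⟩ := exists_eq_snd_smul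
    (Eventually.of_forall fun q => contDiff_iff_contDiffAt.1 (contDiff_dv sF) q) hnull
  have hF0 : F 0 = f p := by rw [hF.self_of_nhds, Function.comp_apply, hx.symm_zero]
  have horth : ∀ y ∈ x.target, ∀ w : Plane,
      inner ℝ (fderiv ℝ (f ∘ x.symm) y w) (ambient ν (x.symm y)) = 0 := by
    intro y hy w
    rw [fderiv_comp y ((sf y hy).differentiableAt (by simp)) (hψd y hy)]
    exact hf.orthogonal _ (hx.symm_mem hy) _
  have hgerm : IsEdgeGerm F n h := by
    refine ⟨sF, sn, sh, ?_, ?_, ?_, hh, ?_, ?_⟩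
    · filter_upwards [hn] with y hy
      rw [hy, real_inner_self_eq_norm_sq]
      simp [ambient]
    · filter_upwards [du_congr hF, hn, hT] with y h1 h2 h3
      rw [h1, h2]
      exact horth y h3 _
    · filter_upwards [dv_congr hF, hn, hT] with y h1 h2 h3
      rw [h1, h2]
      exact horth y h3 _
    · obtain ⟨-, φ, Φ, hpφ, hφ0, hpΦ, hmodel⟩ := hp
      refine indep_of_cuspidalEdge sF sh hh (x.symm.trans φ) Φ ⟨hx.zero_mem_target, ?_⟩ ?_ ?_ ?_
      · change x.symm 0 ∈ φ.source
        rwa [hx.symm_zero]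
      · change φ (x.symm 0) = 0
        rw [hx.symm_zero, hφ0]
      · rwa [hF0]
      · filter_upwards [hF, hx.tendsto_symm.eventually hmodel] with y h1 h2
        rw [h1]
        exact h2
    · intro h0
      have hv := hnull.self_of_nhds rfl
      have h0T := hx.zero_mem_target
      have hpD : p ∈ D := hx.subset hx.mem
      have d1 := (sf 0 h0T).differentiableAt (by simp)
      have d2 := (sν 0 h0T).differentiableAt (by simp)
      rw [(dv_congr hF).self_of_nhds, dv, fderiv_comp 0 d1 (hψd 0 h0T)] at hv
      rw [(dv_congr hn).self_of_nhds, dv, fderiv_comp 0 d2 (hψd 0 h0T)] at h0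
      rw [hx.symm_zero] at d1 d2 hv h0
      have h1 : fderiv ℝ (fun q' => (f q', ambient ν q')) p (fderiv ℝ x.symm 0 (0, 1)) = 0 := by
        rw [(d1.hasFDerivAt.prodMk d2.hasFDerivAt).fderiv]
        exact Prod.ext hv h0
      rw [map_eq_zero_iff _ (hf.immersion p hpD)] at h1
      have h2 := fderiv_partialDiffeo_eq_zero x.symm h0T h1
      simpa using congrArg Prod.snd h2
  have hcurv : ∀ᶠ q in 𝓝 (0 : Plane), gaussCurv F n q = gaussCurv f (ambient ν) (x.symm q) ∧
      meanCurv F n q = meanCurv f (ambient ν) (x.symm q) := by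
    filter_upwards [hF.eventually_nhds, hn.eventually_nhds, hT] with y h1 h2 hy
    have e1 := curvatures_congr h1 h2
    have e2 := curvatures_comp ((sf y hy).differentiableAt (by simp))
      ((sν y hy).differentiableAt (by simp)) (hψd y hy) (partialDiffeo_det_ne_zero x.symm hy)
      (hf.inner_dv_du hD (hx.symm_mem hy))
    exact ⟨e1.1.trans e2.1, e1.2.trans e2.2⟩
  have hflat := hgerm.formL_eq_zero (C := C) (by
    filter_upwards [hx.tendsto_symm.eventually hC, hcurv, hT] with y h1 h2 hy hy2
    rw [h2.1]
    exact h1 (hx.symm_notMem_singularSet hy hy2))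
  obtain ⟨l, sl, hl⟩ := exists_eq_snd_smul
    (Eventually.of_forall fun q => contDiff_iff_contDiffAt.1 hgerm.contDiff_formL q) hflat
  exact ⟨F, n, h, l, hgerm, sl, hl, hF, hn, hcurv.mono fun _ => And.left,
    hcurv.mono fun _ => And.right⟩

namespace IsEdgeData

variable {F n h : Plane → E3} {l : Plane → ℝ}

theorem kappa_eq (E : IsEdgeData f ν x F n h l) : ∀ᶠ q in 𝓝 (0 : Plane),
    kappa1 F n q = kappa1 f (ambient ν) (x.symm q) ∧
      kappa2 F n q = kappa2 f (ambient ν) (x.symm q) := by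
  filter_upwards [E.gauss_eq, E.mean_eq] with q h1 h2
  simp only [kappa1, kappa2, h1, h2, and_self]

theorem cuspidalTorsion_eq_zero_iff (E : IsEdgeData f ν x F n h l) :
    cuspidalTorsion (f ∘ x.symm) 0 = 0 ↔ hatM n h 0 = 0 := by
  have h0 : formL F n 0 = 0 := by
    rw [E.formL_eq.self_of_nhds]
    simp
  rw [← E.germ.cuspidalTorsion_eq_zero_iff h0]
  have hu := du_congr E.front_eq
  have hv := dv_congr E.front_eq
  simp only [cuspidalTorsion, hu.self_of_nhds, (du_congr hu).self_of_nhds,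
    (dv_congr hv).self_of_nhds, (dv_congr (dv_congr hu)).self_of_nhds]

theorem singularCurv_ne_zero_iff (E : IsEdgeData f ν x F n h l) :
    singularCurv (f ∘ x.symm) (ambient ν ∘ x.symm) 0 ≠ 0 ↔ l 0 ≠ 0 := by
  rw [← E.germ.singularCurv_ne_zero_iff E.smooth_l E.formL_eq]
  have hu := du_congr E.front_eq
  have hv := dv_congr E.front_eq
  have hdens : areaDensity F n =ᶠ[𝓝 0] areaDensity (f ∘ x.symm) (ambient ν ∘ x.symm) := by
    filter_upwards [hu, hv, E.normal_eq] with q h1 h2 h3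
    rw [areaDensity, areaDensity, h1, h2, h3]
  simp only [singularCurv, hu.self_of_nhds, (du_congr hu).self_of_nhds,
    (dv_congr hdens).self_of_nhds, E.normal_eq.self_of_nhds]

/-- The cuspidal edge is a singular point of the Gauss map. -/
theorem mem_singularSet_gauss (E : IsEdgeData f ν x F n h l) (hD : IsOpen D) (hf : IsFront D f ν)
    (hx : IsAdapted D f p x) : p ∈ singularSet D (ambient ν) := by
  have hpD : p ∈ D := hx.subset hx.mem
  refine ⟨hpD, (finrank_range_lt_two_iff _).2 fun hinj => ?_⟩
  have h0T := hx.zero_mem_target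
  have hk := (E.germ.kernel_normal E.formL_eq).self_of_nhds rfl
  have d : DifferentiableAt ℝ (ambient ν) (x.symm 0) := by
    rw [hx.symm_zero]
    exact (contDiffAt_ambient (hf.contMDiffAt_gauss hD hpD)).differentiableAt (by simp)
  rw [E.normal_eq.fderiv_eq, fderiv_comp 0 d
    ((contDiffAt_partialDiffeo_symm x h0T).differentiableAt (by simp)), hx.symm_zero,
    ContinuousLinearMap.comp_apply, map_eq_zero_iff _ hinj] at hk
  exact E.germ.hatN_ne_zero (congrArg Prod.fst (fderiv_partialDiffeo_eq_zero x.symm h0T hk))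

/-- The singular point of the Gauss map is non-degenerate exactly if the Gaussian curvature
extends by a non-zero value. -/
theorem isNondegenerate_iff (E : IsEdgeData f ν x F n h l) (hD : IsOpen D) (hf : IsFront D f ν)
    (hx : IsAdapted D f p x) :
    IsNondegenerateSingularPoint D f ν p ↔ hatC n h l 0 ≠ 0 := by
  have dx : DifferentiableAt ℝ x p := (contDiffAt_partialDiffeo x hx.mem).differentiableAt (by simp)
  have hT := hx.eventually_target
  constructor
  · rintro ⟨-, V, κ, hκ, hne⟩ h0
    have hVev : ∀ᶠ y in 𝓝 (0 : Plane), x.symm y ∈ V :=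
      hx.tendsto_symm.eventually (hκ.isOpen.mem_nhds hκ.mem)
    have sκ : ∀ᶠ y in 𝓝 (0 : Plane), ContDiffAt ℝ ∞ (κ ∘ x.symm) y := by
      filter_upwards [hVev, hT] with y h1 h2
      exact (hκ.smooth.contDiffAt (hκ.isOpen.mem_nhds h1)).comp y
        (contDiffAt_partialDiffeo_symm x h2)
    obtain ⟨hu, hv⟩ := E.germ.fderiv_principal E.smooth_l E.formL_eq sκ (by
      filter_upwards [hVev, hT, E.kappa_eq] with y h1 h2 h3 hy
      rw [h3.1, h3.2]
      exact hκ.principal _ ⟨h1, hx.symm_notMem_singularSet h2 hy⟩)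
    rw [h0, zero_div] at hv
    have heq : κ =ᶠ[𝓝 p] (κ ∘ x.symm) ∘ x := by
      filter_upwards [x.open_source.mem_nhds hx.mem] with q hq
      have : x.symm (x q) = q := x.left_inv hq
      simp only [Function.comp_apply, this]
    have d : DifferentiableAt ℝ (κ ∘ x.symm) (x p) := by
      rw [hx.centered]
      exact sκ.self_of_nhds.differentiableAt (by simp)
    apply hne
    rw [(du_congr heq).self_of_nhds, (dv_congr heq).self_of_nhds, du_comp d dx, dv_comp d dx,
      hx.centered, hu, hv]
    simp
  · intro hC
    refine ⟨E.mem_singularSet_gauss hD hf hx, ?_⟩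
    obtain ⟨k, sk, hk⟩ := E.germ.exists_principal E.smooth_l E.formL_eq
    obtain ⟨-, hv⟩ := E.germ.fderiv_principal E.smooth_l E.formL_eq sk hk
    have hev : ∀ᶠ q in 𝓝 p, q ∈ D ∧ q ∈ x.source ∧ ContDiffAt ℝ ∞ k (x q) ∧
        ((x q).2 ≠ 0 → k (x q) = kappa1 f (ambient ν) q ∨ k (x q) = kappa2 f (ambient ν) q) := by
      filter_upwards [x.open_source.mem_nhds hx.mem, hx.tendsto.eventually sk,
        hx.tendsto.eventually hk, hx.tendsto.eventually E.kappa_eq] with q h1 h2 h3 h4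
      have e : x.symm (x q) = q := x.left_inv h1
      rw [e] at h4
      refine ⟨hx.subset h1, h1, h2, fun hq => ?_⟩
      rw [← h4.1, ← h4.2]
      exact h3 hq
    obtain ⟨V, hV, hVo, hpV⟩ := eventually_nhds_iff.1 hev
    refine ⟨V, k ∘ x, ⟨hVo, hpV, fun q hq => (hV q hq).1, fun q hq => ?_, fun q hq => ?_⟩, ?_⟩
    · obtain ⟨-, h1, h2, -⟩ := hV q hq
      exact (h2.comp q (contDiffAt_partialDiffeo x h1)).contDiffWithinAt
    · obtain ⟨-, h1, -, h3⟩ := hV q hq.1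
      exact h3 fun h0 => hq.2 ((hx.singular_iff q h1).2 h0)
    · intro h0
      have h1 : du (k ∘ x) p = 0 := (Prod.mk.inj h0).1
      have h2 : dv (k ∘ x) p = 0 := (Prod.mk.inj h0).2
      have h0T := hx.zero_mem_target
      have heq : k =ᶠ[𝓝 0] (k ∘ x) ∘ x.symm := by
        filter_upwards [hT] with y hy
        simp only [Function.comp_apply, IsAdapted.apply_symm hy]
      have d : DifferentiableAt ℝ (k ∘ x) (x.symm 0) := by
        rw [hx.symm_zero]
        exact ((hV p hpV).2.2.1.comp p (contDiffAt_partialDiffeo x hx.mem)).differentiableAt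
          (by simp)
      rw [(dv_congr heq).self_of_nhds, dv_comp d
        ((contDiffAt_partialDiffeo_symm x h0T).differentiableAt (by simp)), hx.symm_zero, h1,
        h2] at hv
      have h3 := div_ne_zero hC (E.germ.hatB_zero_ne_zero (l := l))
      apply h3
      rw [← hv]
      simp

/-- Coordinates of the sphere preserve the kernel of the differential of the Gauss map. -/
theorem chart_kernel (E : IsEdgeData f ν x F n h l) (hD : IsOpen D) (hf : IsFront D f ν)
    (hx : IsAdapted D f p x) (Ψ : PartialDiffeomorph (𝓡 2) 𝓘(ℝ, Plane) S2 Plane ∞)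
    (hΨ : ν p ∈ Ψ.source) : ∀ᶠ y in 𝓝 (0 : Plane),
      ContDiffAt ℝ ∞ (fun y => Ψ (ν (x.symm y))) y ∧ ν (x.symm y) ∈ Ψ.source ∧
      ∀ w, fderiv ℝ (fun y => Ψ (ν (x.symm y))) y w = 0 ↔ fderiv ℝ n y w = 0 := by
  have hpD : p ∈ D := hx.subset hx.mem
  have hc : ∀ᶠ q in 𝓝 p, ν q ∈ Ψ.source :=
    (hf.contMDiffAt_gauss hD hpD).continuousAt.eventually (Ψ.open_source.mem_nhds hΨ)
  filter_upwards [hx.eventually_target, hx.tendsto_symm.eventually hc,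
    E.normal_eq.eventually_nhds] with y hy h1 h2
  have sν : ContMDiffAt 𝓘(ℝ, Plane) (𝓡 2) ∞ (ν ∘ x.symm) y :=
    (hf.contMDiffAt_gauss hD (hx.symm_mem hy)).comp y
      (contDiffAt_partialDiffeo_symm x hy).contMDiffAt
  have sΨ : ContMDiffAt (𝓡 2) 𝓘(ℝ, Plane) ∞ Ψ (ν (x.symm y)) :=
    Ψ.contMDiffOn_toFun.contMDiffAt (Ψ.open_source.mem_nhds h1)
  refine ⟨(sΨ.comp y sν).contDiffAt, h1, fun w => ?_⟩
  have h3 : fderiv ℝ n y = fderiv ℝ (ambient (ν ∘ x.symm)) y := EventuallyEq.fderiv_eq h2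
  rw [h3]
  exact fderiv_chart_eq_zero_iff sν Ψ h1 w

/-- If `M / v` vanishes at the origin, the kernel of the differential of the Gauss map is tangent to
the singular curve, so the Gauss map has no fold. -/
theorem not_isFold (E : IsEdgeData f ν x F n h l) (hD : IsOpen D) (hf : IsFront D f ν)
    (hx : IsAdapted D f p x) (hM : hatM n h 0 = 0) : ¬ IsFold ν p := by
  rintro ⟨φ, Φ, hpφ, hφ0, hpΦ, hmodel⟩
  let R := x.symm.trans φ
  have hR0 : (0 : Plane) ∈ R.source := by
    refine ⟨hx.zero_mem_target, ?_⟩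
    change x.symm 0 ∈ φ.source
    rwa [hx.symm_zero]
  have hR00 : R 0 = 0 := by
    change φ (x.symm 0) = 0
    rw [hx.symm_zero, hφ0]
  have hRs : ∀ᶠ y in 𝓝 (0 : Plane), y ∈ R.source := R.open_source.mem_nhds hR0
  have heq : (fun y => Φ (ν (x.symm y))) =ᶠ[𝓝 0] fun y => ((R y).1, (R y).2 ^ 2) :=
    hx.tendsto_symm.eventually hmodel
  -- A kernel vector of `d(R₁, R₂²)` is a kernel vector of `dR₁` and of `R₂ dR₂`.
  have hker : ∀ᶠ y in 𝓝 (0 : Plane), ∀ w, fderiv ℝ n y w = 0 →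
      (fderiv ℝ R y w).1 = 0 ∧ (R y).2 * (fderiv ℝ R y w).2 = 0 := by
    filter_upwards [E.chart_kernel hD hf hx Φ hpΦ, heq.eventually_nhds, hRs] with y h1 h2 h3 w hw
    have dR := ((contDiffAt_partialDiffeo R h3).differentiableAt (by simp)).hasFDerivAt
    have h4 := (h1.2.2 w).2 hw
    have h5 : HasFDerivAt (fun y => ((R y).1, (R y).2 ^ 2)) _ y := dR.fst.prodMk (dR.snd.pow 2)
    rw [EventuallyEq.fderiv_eq h2, h5.fderiv] at h4
    have h6 := (Prod.mk.inj h4).1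
    have h7 := (Prod.mk.inj h4).2
    refine ⟨h6, ?_⟩
    simp at h7
    rcases h7 with h7 | h7
    · rw [h7, zero_mul]
    · rw [h7, mul_zero]
  have hN : ∀ᶠ y in 𝓝 (0 : Plane), hatN n h y ≠ 0 :=
    E.germ.contDiff_hatN.continuous.continuousAt.eventually_ne E.germ.hatN_ne_zero
  have hkn := E.germ.kernel_normal E.formL_eq
  -- The singular curve of the Gauss map lies in that of the model.
  have haxis : ∀ᶠ y in 𝓝 (0 : Plane), y.2 = 0 → (R y).2 = 0 := by
    filter_upwards [hker, hN, hkn, hRs] with y h1 h2 h3 h4 hy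
    by_contra h5
    obtain ⟨h6, h7⟩ := h1 _ (h3 hy)
    have h8 := fderiv_partialDiffeo_eq_zero R h4
      (Prod.ext h6 ((mul_eq_zero.1 h7).resolve_left h5))
    exact h2 (congrArg Prod.fst h8)
  have sR2 : ∀ᶠ y in 𝓝 (0 : Plane), ContDiffAt ℝ ∞ (fun y => (R y).2) y := by
    filter_upwards [hRs] with y hy using contDiffAt_snd.comp y (contDiffAt_partialDiffeo R hy)
  obtain ⟨k, sk, hk⟩ := exists_eq_snd_smul sR2 haxis
  have hu2 : du (fun y => (R y).2) 0 = 0 := du_snd_smul rfl sk.continuous.continuousAt hk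
  have dR := ((contDiffAt_partialDiffeo R hR0).differentiableAt (by simp)).hasFDerivAt
  have hu2' : (du R 0).2 = 0 := by
    rw [du, dR.snd.fderiv] at hu2
    exact hu2
  have hu1 := (hker.self_of_nhds _ (hkn.self_of_nhds rfl)).1
  rw [fderiv_apply_eq_du_dv, hM] at hu1
  have hu1' : (du R 0).1 = 0 := by
    have : hatN n h 0 * (du R 0).1 = 0 := by simpa using hu1
    exact (mul_eq_zero.1 this).resolve_left E.germ.hatN_ne_zero
  have h9 : ((1, 0) : Plane) = 0 := fderiv_partialDiffeo_eq_zero R hR0 (Prod.ext hu1' hu2')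
  simpa using congrArg Prod.fst h9

/-- If `M / v` does not vanish at a non-degenerate singular point of the Gauss map, the kernel of
its differential is transverse to the singular curve, and the Gauss map has a fold. -/
theorem isFold (E : IsEdgeData f ν x F n h l) (hD : IsOpen D) (hf : IsFront D f ν)
    (hx : IsAdapted D f p x) (hM : hatM n h 0 ≠ 0) (hC : hatC n h l 0 ≠ 0) : IsFold ν p := by
  obtain ⟨Ψ, hpΨ, hΨ0⟩ := exists_sphere_coordinates (ν p)
  have hch := E.chart_kernel hD hf hx Ψ hpΨ
  obtain ⟨G, sG, hG⟩ := exists_contDiff_eventuallyEq (hch.mono fun _ hy => hy.1)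
  have hG0 : G 0 = 0 := by
    rw [hG.self_of_nhds]
    change Ψ (ν (x.symm 0)) = 0
    rw [hx.symm_zero, hΨ0]
  have h0Ψ : (0 : Plane) ∈ Ψ.target := by
    have := Ψ.map_source hpΨ
    rwa [show Ψ.toPartialEquiv (ν p) = (0 : Plane) from hΨ0] at this
  -- The inverse of the coordinate system, as a map into 3-space.
  obtain ⟨ι, sι, hι⟩ := exists_contDiff_eventuallyEq
    (g := fun z : Plane => ((Ψ.symm z : S2) : E3)) (a := 0) (by
      filter_upwards [Ψ.open_target.mem_nhds h0Ψ] with z hz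
      have h1 : ContMDiffAt 𝓘(ℝ, Plane) (𝓡 2) ∞ Ψ.symm z :=
        Ψ.contMDiffOn_invFun.contMDiffAt (Ψ.open_target.mem_nhds hz)
      exact (contMDiff_coe_S2.contMDiffAt.comp z h1).contDiffAt)
  have htG : Tendsto G (𝓝 0) (𝓝 0) := by
    have := sG.continuous.tendsto 0
    rwa [hG0] at this
  have hn : n =ᶠ[𝓝 0] ι ∘ G := by
    filter_upwards [E.normal_eq, hG, htG.eventually hι, hch] with y h1 h2 h3 h4
    rw [Function.comp_apply, h3, h1, h2]
    have : Ψ.symm (Ψ (ν (x.symm y))) = ν (x.symm y) := Ψ.left_inv h4.2.1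
    rw [this]
    rfl
  let g₁ : Plane → ℝ := fun y => (G y).1
  let g₂ : Plane → ℝ := fun y => (G y).2
  have sg₁ : ContDiff ℝ ∞ g₁ := contDiff_fst.comp sG
  have sg₂ : ContDiff ℝ ∞ g₂ := contDiff_snd.comp sG
  have dG : ∀ y, HasFDerivAt G (fderiv ℝ G y) y :=
    fun y => (sG.differentiable (by simp) y).hasFDerivAt
  have hg₁ : ∀ y w, fderiv ℝ g₁ y w = (fderiv ℝ G y w).1 := fun y w => by
    have e : fderiv ℝ g₁ y = _ := (dG y).fst.fderiv
    rw [e]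
    rfl
  have hg₂ : ∀ y w, fderiv ℝ g₂ y w = (fderiv ℝ G y w).2 := fun y w => by
    have e : fderiv ℝ g₂ y = _ := (dG y).snd.fderiv
    rw [e]
    rfl
  have hker : ∀ᶠ y in 𝓝 (0 : Plane), ∀ w, fderiv ℝ G y w = 0 ↔ fderiv ℝ n y w = 0 := by
    filter_upwards [hch, hG.eventually_nhds] with y h1 h2 w
    rw [EventuallyEq.fderiv_eq h2]
    exact h1.2.2 w
  have hN : ∀ᶠ y in 𝓝 (0 : Plane), hatN n h y ≠ 0 :=
    E.germ.contDiff_hatN.continuous.continuousAt.eventually_ne E.germ.hatN_ne_zero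
  have hJ0 : ∀ᶠ y in 𝓝 (0 : Plane), y.2 = 0 → jacobian g₁ g₂ y = 0 := by
    filter_upwards [hker, E.germ.kernel_normal E.formL_eq, hN] with y h1 h2 h3 hy
    have h4 := (h1 _).2 (h2 hy)
    have h5 := hg₁ y (hatN n h y, -hatM n h y)
    have h6 := hg₂ y (hatN n h y, -hatM n h y)
    rw [h4, fderiv_apply_eq_du_dv] at h5 h6
    simp only [smul_eq_mul, Prod.fst_zero, Prod.snd_zero] at h5 h6
    apply (mul_eq_zero.1 (_ : hatN n h y * jacobian g₁ g₂ y = 0)).resolve_left h3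
    rw [jacobian]
    linear_combination dv g₂ y * h5 - dv g₁ y * h6
  have hu : du g₁ 0 ≠ 0 ∨ du g₂ 0 ≠ 0 := by
    by_contra! hcon
    have h1 : fderiv ℝ G 0 (1, 0) = 0 :=
      Prod.ext ((hg₁ 0 (1, 0)).symm.trans hcon.1) ((hg₂ 0 (1, 0)).symm.trans hcon.2)
    have h2 : du n 0 = 0 := (hker.self_of_nhds _).1 h1
    apply hM
    rw [hatM, h2, inner_zero_right, neg_zero]
  have sJ : ContDiff ℝ ∞ (jacobian g₁ g₂) :=
    ((contDiff_du sg₁).mul (contDiff_dv sg₂)).sub ((contDiff_du sg₂).mul (contDiff_dv sg₁))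
  obtain ⟨j, sj, hj⟩ := exists_eq_snd_smul
    (Eventually.of_forall fun q => contDiff_iff_contDiffAt.1 sJ q) hJ0
  -- Comparing `det(n_u, n_v, n)` in both descriptions shows that `J / v` does not vanish.
  let vol : Plane → ℝ := fun y => det3 (du ι (G y)) (dv ι (G y)) (n y)
  let δ : Plane → ℝ := fun y => det3 (du F y) (h y) (n y)
  have cvol : Continuous vol := continuous_det3 ((contDiff_du sι).continuous.comp sG.continuous)
    ((contDiff_dv sι).continuous.comp sG.continuous) E.germ.smooth_normal.continuous
  have cδ : Continuous δ := continuous_det3 (contDiff_du E.germ.smooth).continuous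
    E.germ.smooth_factor.continuous E.germ.smooth_normal.continuous
  have hdet : ∀ᶠ y in 𝓝 (0 : Plane), y.2 ≠ 0 → j y * (vol y * δ y) = hatC n h l y := by
    filter_upwards [hn.eventually_nhds, hj, E.germ.det3_normal E.formL_eq] with y h1 h2 h3 hy
    have h1' : n =ᶠ[𝓝 y] ι ∘ G := h1
    have dι := sι.differentiable (by simp) (G y)
    have e1 : du n y = du g₁ y • du ι (G y) + du g₂ y • dv ι (G y) := by
      rw [(du_congr h1').self_of_nhds, du_comp dι (dG y).differentiableAt,
        show (du G y).1 = du g₁ y from (hg₁ y _).symm,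
        show (du G y).2 = du g₂ y from (hg₂ y _).symm]
    have e2 : dv n y = dv g₁ y • du ι (G y) + dv g₂ y • dv ι (G y) := by
      rw [(dv_congr h1').self_of_nhds, dv_comp dι (dG y).differentiableAt,
        show (dv G y).1 = dv g₁ y from (hg₁ y _).symm,
        show (dv G y).2 = dv g₂ y from (hg₂ y _).symm]
    have e3 : det3 (du n y) (dv n y) (n y) = jacobian g₁ g₂ y * vol y := by
      rw [e1, e2, jacobian]
      simp only [vol, det3_eq, PiLp.add_apply, PiLp.smul_apply, smul_eq_mul]
      ring
    apply mul_left_cancel₀ hy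
    rw [← h3, e3, h2, smul_eq_mul]
    ring
  have hj0 : j 0 ≠ 0 := by
    have := (eventually_eq_of_off_axis (sj.continuous.mul (cvol.mul cδ))
      (E.germ.contDiff_hatC E.smooth_l).continuous hdet).self_of_nhds
    rw [← this] at hC
    exact left_ne_zero_of_mul hC
  have hJ : dv (jacobian g₁ g₂) 0 ≠ 0 := by
    rwa [dv_snd_smul rfl sj.continuous.continuousAt hj]
  obtain ⟨φ, Φ, hφ, hφ0, hΦ, hnf⟩ := exists_fold_normal_form_of_or sg₁ sg₂
    (congrArg Prod.fst hG0) (congrArg Prod.snd hG0) hu hJ0 hJ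
  refine ⟨x.trans φ, Ψ.trans Φ, ⟨hx.mem, ?_⟩, ?_, ⟨hpΨ, ?_⟩, ?_⟩
  · change x p ∈ φ.source
    rwa [hx.centered]
  · change φ (x p) = 0
    rw [hx.centered, hφ0]
  · change Ψ (ν p) ∈ Φ.source
    rwa [hΨ0]
  · filter_upwards [hx.tendsto.eventually hnf, hx.tendsto.eventually hG,
      x.open_source.mem_nhds hx.mem] with q h1 h2 h3
    have e : x.symm (x q) = q := x.left_inv h3
    rw [e] at h2
    change Φ (Ψ (ν q)) = ((φ (x q)).1, (φ (x q)).2 ^ 2)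
    rw [← h1, ← h2]

end IsEdgeData

end Adapted

end GaussMapCusp
end

theorem mainTheorem5 (D : Set GaussMapCusp.Plane) (hDopen : IsOpen D) (hDconn : IsConnected D)
    (f : GaussMapCusp.Plane → GaussMapCusp.E3) (ν : GaussMapCusp.Plane → GaussMapCusp.S2)
    (hf : GaussMapCusp.IsFront D f ν)
    (p : GaussMapCusp.Plane) (hp : GaussMapCusp.IsCuspidalEdge D f p)
    (hK : GaussMapCusp.GaussCurvNonzeroBoundedNear D f ν p)
    (x : PartialDiffeomorph 𝓘(ℝ, GaussMapCusp.Plane) 𝓘(ℝ, GaussMapCusp.Plane)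
      GaussMapCusp.Plane GaussMapCusp.Plane ∞)
    (hx : GaussMapCusp.IsAdapted D f p x) :
    (GaussMapCusp.IsNondegenerateSingularPoint D f ν p ∧ ¬ GaussMapCusp.IsFold ν p) ↔
      (GaussMapCusp.cuspidalTorsion (f ∘ x.symm) 0 = 0 ∧
        GaussMapCusp.singularCurv (f ∘ x.symm) (GaussMapCusp.ambient ν ∘ x.symm) 0 ≠ 0) := by
  obtain ⟨C, hC⟩ := hK
  obtain ⟨F, n, h, l, E⟩ := GaussMapCusp.exists_isEdgeData hDopen hf hp
    (hC.mono fun q hq hqS => (hq hqS).2) hx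
  have hN := E.germ.hatN_ne_zero
  rw [E.isNondegenerate_iff hDopen hf hx, E.cuspidalTorsion_eq_zero_iff,
    E.singularCurv_ne_zero_iff]
  constructor
  · rintro ⟨h1, h2⟩
    have hM : GaussMapCusp.hatM n h 0 = 0 :=
      not_not.1 fun hM => h2 (E.isFold hDopen hf hx hM h1)
    refine ⟨hM, fun hl => h1 ?_⟩
    rw [GaussMapCusp.hatC, hM, hl]
    ring
  · rintro ⟨hM, hl⟩
    refine ⟨?_, E.not_isFold hDopen hf hx hM⟩
    rw [GaussMapCusp.hatC, hM]
    simpa using ⟨hl, hN⟩
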